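/- Let $t_0\in\mathbb R$ and let $a_{11},a_{12},a_{21},a_{22}:[t_0,\infty)\to\mathbb R$ be continuous. Consider real solutions $(\phi,\psi)$ on $[t_0,\infty)$ of $$\phi'=a_{11}\phi+a_{12}\psi,\qquad \psi'=a_{21}\phi+a_{22}\psi. \tag{1}$$ Put $B=a_{11}-a_{22}$, $S=a_{11}+a_{22}$, $J_u(t_1;t)=\exp\int_{t_1}^t u(\tau)\,d\tau$, $J_u(t)=J_u(t_0;t)$, $I^+_{u,v}(t_0)=\int_{t_0}^{\infty}u(\tau)J_{-v}(t_0;\tau)\,d\tau$ and $I^-_{u,v}(t_0;t)=\int_{t_0}^{t}J_{-u}(\tau;t)v(\tau)\,d\tau$. Suppose that $a_{12}(t)\ge 0$ and $a_{21}(t)\ge 0$ for $t\ge t_0$, and that $a_{12}$ and $a_{21}$ have unbounded supports. **A.** Suppose $I^+_{a_{12},B}(t_0)=+\infty$ or $I^+_{a_{21},-B}(t_0)=+\infty$. Then there is a solution $(\phi_*,\psi_*)$ of (1), unique up to a multiplier, such that $\phi_*(t)>0>\psi_*(t)$ for all $t\ge t_0$. It satisfies $$\int_{t_0}^{\infty}\frac{a_{12}J_S}{\phi_*^2}\,d\tau=\int_{t_0}^{\infty}\frac{a_{21}J_S}{\psi_*^2}\,d\tau=+\infty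 .$$ For every solution $(\phi,\psi)$ linearly independent of $(\phi_*,\psi_*)$, $$\lim_{t\to\infty}\frac{\phi_*(t)}{\phi(t)}=\lim_{t\to\infty}\frac{\psi_*(t)}{\psi(t)}=0;$$ there is $T\ge t_0$ such that $\phi(t)\neq0$ and $\psi(t)\ne0$ for all $t\ge T$, and for every such $T$ $$\int_{T}^{\infty}\frac{a_{12}J_S}{\phi^2}\,d\tau<+\infty,\qquad \int_{T}^{\infty}\frac{a_{21}J_S}{\psi^2}\,d\tau<+\infty .$$ Moreover, for all such $(\phi,\psi)$ and $T$: (a) if $I^+_{a_{12},B}(t_0)=+\infty$, then $\int_{t_0}^\infty a_{21}\frac{\phi_*}{\psi_*}\,d\tau=-\infty$ and $\int_T^\infty a_{12}\frac{\psi}{\phi}\,d\tau=+\infty$; if $I^+_{a_{21},-B}(t_0)=+\infty$, then $\int_{t_0}^\infty a_{12}\frac{\psi_*}{\phi_*}\,d\tau=-\infty$ and $\int_T^\infty a_{21}\frac{\phi}{\psi}\,d\tau=+\infty$; (b) if $I^+_{a_{12},B}(t_0)=+\infty$ and $\int_{t_0}^\infty a_{21}(\tau)I^-_{-B,a_{12}}(t_0;\tau)\,d\tau<+\infty$,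 then $\int_{t_0}^\infty a_{12}\left|\frac{\psi_*}{\phi_*}\right|d\tau<+\infty$ and $\int_{t_0}^\infty a_{21}\frac{\phi_*}{\psi_*}\,d\tau=-\infty$; if $I^+_{a_{21},-B}(t_0)=+\infty$ and $\int_{t_0}^\infty a_{12}(\tau)I^-_{B,a_{21}}(t_0;\tau)\,d\tau<+\infty$, then $\int_{t_0}^\infty a_{21}\left|\frac{\phi_*}{\psi_*}\right|d\tau<+\infty$ and $\int_{t_0}^\infty a_{12}\frac{\psi_*}{\phi_*}\,d\tau=-\infty$. **B.** Suppose $I^+_{a_{12},B}(t_0)<+\infty$ and $I^+_{a_{21},-B}(t_0)<+\infty$. Then there are linearly independent solutions $(\phi_{**},\psi_0)$ and $(\phi_0,\psi_{**})$ of (1) with $\phi_{**}(t)>0$ and $\psi_{**}(t)>0$ for all $t\ge t_0$, such that $$\int_{t_0}^{\infty}\frac{a_{12}J_S}{\phi_{**}^2}\,d\tau=\int_{t_0}^{\infty}\frac{a_{21}J_S}{\psi_{**}^2}\,d\tau=+\infty$$ and the following holds. For every solution $(\phi,\psi)$ linearly independent of $(\phi_{**},\psi_0)$ (respectively, of $(\phi_0,\psi_{**})$),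 $$\lim_{t\to\infty}\frac{\phi_{**}(t)}{\phi(t)}=0\qquad\Bigl(\text{respectively, }\lim_{t\to\infty}\frac{\psi_{**}(t)}{\psi(t)}=0\Bigr);$$ there is $T\ge t_0$ such that $\phi(t)\ne0$ and $\psi(t)\neq0$ for all $t\ge T$, and for every such $T$ $$\int_{T}^{\infty}\frac{a_{12}J_S}{\phi^2}\,d\tau<+\infty\qquad\Bigl(\text{respectively, }\int_{T}^{\infty}\frac{a_{21}J_S}{\psi^2}\,d\tau<+\infty\Bigr).$$ Each of the two solutions is determined up to a multiplier by this limit property: every solution $(u,v)$ with $u/\phi\to0$ (respectively, $v/\psi\to 0$) as $t\to\infty$ for all solutions $(\phi,\psi)$ linearly independent of $(u,v)$ is a constant multiple of $(\phi_{**},\psi_0)$ (respectively, of $(\phi_0,\psi_{**})$). -/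

import Mathlib

open Set Filter Topology MeasureTheory

noncomputable section

/-- The coefficients of a planar linear system
`φ' = a11 φ + a12 ψ`, `ψ' = a21 φ + a22 ψ`. -/
structure PlanarSystem where
  a11 : ℝ → ℝ
  a12 : ℝ → ℝ
  a21 : ℝ → ℝ
  a22 : ℝ → ℝ

/-- `B = a11 - a22`. -/
def PlanarSystem.B (A : PlanarSystem) : ℝ → ℝ := fun t => A.a11 t - A.a22 t

/-- `S = a11 + a22`. -/
def PlanarSystem.S (A : PlanarSystem) : ℝ → ℝ := fun t => A.a11 t + A.a22 t

/-- `(φ, ψ)` solves the system on `[t₀, ∞)` (the derivative at `t₀` is one-sided). Values to the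
left of `t₀` are irrelevant. -/
def PlanarSystem.IsSolution (A : PlanarSystem) (t₀ : ℝ) (φ ψ : ℝ → ℝ) : Prop :=
  ∀ t ≥ t₀,
    HasDerivWithinAt φ (A.a11 t * φ t + A.a12 t * ψ t) (Ici t₀) t ∧
    HasDerivWithinAt ψ (A.a21 t * φ t + A.a22 t * ψ t) (Ici t₀) t

/-- The pairs `(φ, ψ)` and `(u, v)` are linearly independent as functions on `[t₀, ∞)`. -/
def LinIndepFrom (t₀ : ℝ) (φ ψ u v : ℝ → ℝ) : Prop :=
  LinearIndependent ℝ
    ![fun t : Ici t₀ => ((φ t, ψ t) : ℝ × ℝ), fun t : Ici t₀ => ((u t, v t) : ℝ × ℝ)]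

/-- Both components have no zero on `[T, ∞)`. -/
def NonvanishingFrom (T : ℝ) (φ ψ : ℝ → ℝ) : Prop :=
  ∀ t ≥ T, φ t ≠ 0 ∧ ψ t ≠ 0

/-- `J_u(t₁; t) = exp ∫_{t₁}^t u`. -/
def expInt (u : ℝ → ℝ) (t₁ t : ℝ) : ℝ := Real.exp (∫ τ in t₁..t, u τ)

/-- `I⁺_{u,v}(t₁; t) = ∫_{t₁}^t u(τ) J_{-v}(t₁; τ) dτ`. -/
def Iplus (u v : ℝ → ℝ) (t₁ t : ℝ) : ℝ := ∫ τ in t₁..t, u τ * expInt (-v) t₁ τ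

/-- `I⁻_{u,v}(t₁; t) = ∫_{t₁}^t J_{-u}(τ; t) v(τ) dτ`. -/
def Iminus (u v : ℝ → ℝ) (t₁ t : ℝ) : ℝ := ∫ τ in t₁..t, expInt (-u) τ t * v τ

/-- `I⁺_{u,v}(t₁) = +∞`. -/
def IplusInfinite (u v : ℝ → ℝ) (t₁ : ℝ) : Prop := Tendsto (Iplus u v t₁) atTop atTop

/-- `I⁺_{u,v}(t₁) < +∞`: the improper integral converges. -/
def IplusFinite (u v : ℝ → ℝ) (t₁ : ℝ) : Prop := ∃ L : ℝ, Tendsto (Iplus u v t₁) atTop (𝓝 L)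

/-- `∫_T^{+∞} g = +∞` as an improper integral (used for `g` continuous on `[T, ∞)`). -/
def IntegralTop (g : ℝ → ℝ) (T : ℝ) : Prop :=
  Tendsto (fun t => ∫ τ in T..t, g τ) atTop atTop

/-- `∫_T^{+∞} g = -∞` as an improper integral (used for `g` continuous on `[T, ∞)`). -/
def IntegralBot (g : ℝ → ℝ) (T : ℝ) : Prop :=
  Tendsto (fun t => ∫ τ in T..t, g τ) atTop atBot

/-- The improper integral `∫_T^{+∞} g` converges to a real number; for `g ≥ 0` this is
`∫_T^{+∞} g < +∞` (used for `g` continuous on `[T, ∞)`). -/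
def IntegralConv (g : ℝ → ℝ) (T : ℝ) : Prop :=
  ∃ L : ℝ, Tendsto (fun t => ∫ τ in T..t, g τ) atTop (𝓝 L)

/-- The weight `a12 J_S / φ²`, where `J_S(τ) = J_S(t₀; τ)`. -/
def PlanarSystem.weight12 (A : PlanarSystem) (t₀ : ℝ) (φ : ℝ → ℝ) : ℝ → ℝ :=
  fun τ => A.a12 τ * expInt A.S t₀ τ / φ τ ^ 2

/-- The weight `a21 J_S / ψ²`, where `J_S(τ) = J_S(t₀; τ)`. -/
def PlanarSystem.weight21 (A : PlanarSystem) (t₀ : ℝ) (ψ : ℝ → ℝ) : ℝ → ℝ :=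
  fun τ => A.a21 τ * expInt A.S t₀ τ / ψ τ ^ 2

end

/-! Dividing `φ` and `ψ` by the exponentials of the integrals of `a11` and `a22` turns the system
into `x' = p y`, `y' = q x` with `p = a12 J_{-B}` and `q = a21 J_B`. The two integrals `I⁺` become
`∫ p` and `∫ q`, the weights become `p / x ^ 2` and `q / y ^ 2`, and Wronskians become constant.

Let `(x₁, y₁)` and `(x₂, y₂)` start from `(1, 0)` and `(0, 1)`. All components stay nonnegative, and
the Wronskian is 1. Hence `x₂ / x₁` and `y₁ / y₂` are nondecreasing, with product `1 - 1 / (x₁ y₂) <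
1`. Since `p` and `q` have unbounded supports, each ratio becomes positive and so bounds the other;
they converge to limits `α, γ > 0` that are never attained (`exists_tendsto_ratio`). Relative to
`x₁`, the component `α x₁ - x₂` tends to 0, while the first component of any independent solution
has a nonzero limit. So `α (x₁, y₁) - (x₂, y₂)` is principal in its first component, and by symmetry
`γ (x₂, y₂) - (x₁, y₁)` is principal in its second. The statements on weighted integrals follow
because the derivative of a quotient of first components is a constant times `p / u ^ 2`.

The two cases are separated by `α γ`, the limit of `1 - 1 / (x₁ y₂)`. If `∫ p` or `∫ q` diverges,
then `x₁ y₂ → ∞` and `α γ = 1`: the two principal solutions are proportional and give one solution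
with components of opposite signs. If both converge, a Grönwall estimate bounds `x₁` and `y₂`, so `α
γ < 1` and the two are independent.

In (a) the integrands are logarithmic derivatives of the components. Part (b) needs a positive lower
bound for the positive component `x`, obtained by comparing `x` with `x - y ∫ p`. -/

noncomputable section

/-! ### Linear differential equations on the line -/

section LinearODE

variable {E : Type*} [NormedAddCommGroup E] [NormedSpace ℝ E]

/-- The terms of the Picard series of the linear equation `z' = A z`, `z t₀ = v`. -/
def picardTerm (A : ℝ → E →L[ℝ] E) (t₀ : ℝ) (v : E) : ℕ → ℝ → E
  | 0 => fun _ => v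
  | n + 1 => fun t => ∫ s in t₀..t, A s (picardTerm A t₀ v n s)

theorem continuous_picardTerm {A : ℝ → E →L[ℝ] E} (hA : Continuous A) (t₀ : ℝ) (v : E) (n : ℕ) :
    Continuous (picardTerm A t₀ v n) := by
  induction n with
  | zero => exact continuous_const
  | succ n ih =>
    exact intervalIntegral.continuous_primitive
      (fun a b => (hA.clm_apply ih).intervalIntegrable a b) t₀

theorem hasDerivAt_picardTerm_succ [CompleteSpace E] {A : ℝ → E →L[ℝ] E} (hA : Continuous A)
    (t₀ : ℝ) (v : E) (n : ℕ) (t : ℝ) :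
    HasDerivAt (picardTerm A t₀ v (n + 1)) (A t (picardTerm A t₀ v n t)) t := by
  have hc := hA.clm_apply (continuous_picardTerm hA t₀ v n)
  exact intervalIntegral.integral_hasDerivAt_right (hc.intervalIntegrable _ _)
    (hc.stronglyMeasurableAtFilter _ _) hc.continuousAt

theorem norm_picardTerm_le {A : ℝ → E →L[ℝ] E} {t₀ R C : ℝ}
    (hC : ∀ t, |t - t₀| ≤ R → ‖A t‖ ≤ C) (v : E) (n : ℕ) (t : ℝ) (ht : |t - t₀| ≤ R) :
    ‖picardTerm A t₀ v n t‖ ≤ ‖v‖ * C ^ n * |t - t₀| ^ n / n.factorial := by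
  have hC0 : 0 ≤ C := (norm_nonneg _).trans (hC t ht)
  induction n generalizing t with
  | zero => simp [picardTerm]
  | succ n ih =>
    have hb : ‖picardTerm A t₀ v (n + 1) t‖ ≤
        |∫ s in t₀..t, ‖v‖ * C ^ (n + 1) / n.factorial * |s - t₀| ^ n| := by
      refine intervalIntegral.norm_integral_le_abs_of_norm_le ?_ ?_
      · refine (ae_restrict_iff' measurableSet_uIoc).2 (ae_of_all _ fun s hs => ?_)
        have hs' : |s - t₀| ≤ R := (abs_sub_left_of_mem_uIcc (uIoc_subset_uIcc hs)).trans ht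
        calc ‖A s (picardTerm A t₀ v n s)‖ ≤ ‖A s‖ * ‖picardTerm A t₀ v n s‖ :=
              (A s).le_opNorm _
          _ ≤ C * (‖v‖ * C ^ n * |s - t₀| ^ n / n.factorial) := by
              gcongr
              · exact hC s hs'
              · exact ih s hs'
          _ = _ := by ring
      · exact (by fun_prop : Continuous _).intervalIntegrable _ _
    refine hb.trans (le_of_eq ?_)
    rw [intervalIntegral.integral_const_mul, abs_mul,
      intervalIntegral.abs_integral_eq_abs_integral_uIoc, integral_pow_abs_sub_uIoc,
      abs_of_nonneg (by positivity), abs_of_nonneg (by positivity), Nat.factorial_succ]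
    push_cast
    field_simp

/-- A linear equation with continuous coefficients has global solutions. -/
theorem exists_linearODE_solution [CompleteSpace E] {A : ℝ → E →L[ℝ] E} (hA : Continuous A)
    (t₀ : ℝ) (v : E) : ∃ z : ℝ → E, z t₀ = v ∧ ∀ t, HasDerivAt z (A t (z t)) t := by
  have key : ∀ R : ℝ, ∃ C : ℝ, 0 ≤ C ∧ ∀ t, |t - t₀| ≤ R → ‖A t‖ ≤ C := by
    intro R
    obtain ⟨C, hC⟩ := (isCompact_Icc (a := t₀ - R) (b := t₀ + R)).exists_bound_of_continuousOn
      hA.continuousOn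
    refine ⟨max C 0, le_max_right _ _, fun t ht => (hC t ?_).trans (le_max_left _ _)⟩
    rw [abs_le] at ht
    exact ⟨by linarith, by linarith⟩
  have hsumm : ∀ R C : ℝ, 0 ≤ R → Summable fun n : ℕ =>
      ‖v‖ * C ^ n * R ^ n / n.factorial := by
    intro R C _
    refine ((Real.summable_pow_div_factorial (C * R)).mul_left ‖v‖).congr fun n => ?_
    rw [mul_pow]; ring
  have hbound : ∀ R C : ℝ, 0 ≤ C → (∀ t, |t - t₀| ≤ R → ‖A t‖ ≤ C) → ∀ n t, |t - t₀| ≤ R →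
      ‖picardTerm A t₀ v n t‖ ≤ ‖v‖ * C ^ n * R ^ n / n.factorial := by
    intro R C hC0 hC n t ht
    refine (norm_picardTerm_le hC v n t ht).trans ?_
    gcongr
  have hz : ∀ t, Summable fun n => picardTerm A t₀ v n t := by
    intro t
    obtain ⟨C, hC0, hC⟩ := key |t - t₀|
    exact (hsumm _ C (abs_nonneg _)).of_norm_bounded
      fun n => hbound _ C hC0 hC n t le_rfl
  refine ⟨fun t => v + ∑' n, picardTerm A t₀ v (n + 1) t, ?_, fun t => ?_⟩
  · simp [picardTerm]
  -- The extra 1 puts `t` in the interior of the interval where the derived series is dominated.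
  · set R := |t - t₀| + 1 with hR
    have hR0 : 0 ≤ R := by positivity
    obtain ⟨C, hC0, hC⟩ := key R
    have hmem : ∀ s ∈ Ioo (t₀ - R) (t₀ + R), |s - t₀| ≤ R := fun s hs =>
      abs_le.2 ⟨by linarith [hs.1], by linarith [hs.2]⟩
    have ht : t ∈ Ioo (t₀ - R) (t₀ + R) := by
      constructor <;> linarith [neg_abs_le (t - t₀), le_abs_self (t - t₀)]
    have hd := hasDerivAt_tsum_of_isPreconnected ((hsumm R C hR0).mul_left C)
      isOpen_Ioo isPreconnected_Ioo
      (fun n s _ => hasDerivAt_picardTerm_succ hA t₀ v n s)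
      (fun n s hs => ((A s).le_opNorm _).trans (mul_le_mul (hC s (hmem s hs))
        (hbound R C hC0 hC n s (hmem s hs)) (norm_nonneg _) hC0))
      ht ((summable_nat_add_iff 1).2 (hz t)) ht
    convert hd.const_add v using 1
    rw [← (A t).map_tsum (hz t), (hz t).tsum_eq_zero_add]
    rfl

end LinearODE

/-! ### Functions differentiable on a half-line -/

section HalfLine

variable {f g : ℝ → ℝ} {T : ℝ}

theorem continuousOn_of_hasDerivWithinAt_Ici
    (hf : ∀ t ≥ T, HasDerivWithinAt f (g t) (Ici T) t) : ContinuousOn f (Ici T) :=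
  fun t ht => (hf t ht).continuousWithinAt

theorem monotoneOn_of_hasDerivWithinAt_Ici (hf : ∀ t ≥ T, HasDerivWithinAt f (g t) (Ici T) t)
    (hg : ∀ t ≥ T, 0 ≤ g t) : MonotoneOn f (Ici T) :=
  monotoneOn_of_hasDerivWithinAt_nonneg (convex_Ici T) (continuousOn_of_hasDerivWithinAt_Ici hf)
    (fun t ht => (hf t (interior_subset ht)).mono interior_subset)
    (fun t ht => hg t (interior_subset ht))

theorem antitoneOn_of_hasDerivWithinAt_Ici (hf : ∀ t ≥ T, HasDerivWithinAt f (g t) (Ici T) t)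
    (hg : ∀ t ≥ T, g t ≤ 0) : AntitoneOn f (Ici T) :=
  antitoneOn_of_hasDerivWithinAt_nonpos (convex_Ici T) (continuousOn_of_hasDerivWithinAt_Ici hf)
    (fun t ht => (hf t (interior_subset ht)).mono interior_subset)
    (fun t ht => hg t (interior_subset ht))

theorem eq_of_hasDerivWithinAt_zero_Ici (hf : ∀ t ≥ T, HasDerivWithinAt f 0 (Ici T) t)
    {t : ℝ} (ht : T ≤ t) : f t = f T :=
  le_antisymm
    (antitoneOn_of_hasDerivWithinAt_Ici (g := fun _ => 0) hf (fun _ _ => le_rfl) (mem_Ici.2 le_rfl) ht ht)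
    (monotoneOn_of_hasDerivWithinAt_Ici (g := fun _ => 0) hf (fun _ _ => le_rfl) (mem_Ici.2 le_rfl) ht ht)

theorem integral_eq_sub_of_hasDerivWithinAt_Ici
    (hf : ∀ t ≥ T, HasDerivWithinAt f (g t) (Ici T) t) (hg : ContinuousOn g (Ici T))
    {t : ℝ} (ht : T ≤ t) : ∫ τ in T..t, g τ = f t - f T :=
  intervalIntegral.integral_eq_sub_of_hasDeriv_right_of_le ht
    ((continuousOn_of_hasDerivWithinAt_Ici hf).mono Icc_subset_Ici_self)
    (fun x hx => (hf x hx.1.le).mono (Ioi_subset_Ici hx.1.le))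
    (ContinuousOn.intervalIntegrable_of_Icc ht (hg.mono Icc_subset_Ici_self))

theorem continuousOn_Ici_intervalIntegrable (hg : ContinuousOn g (Ici T)) {a b : ℝ} (ha : T ≤ a)
    (hb : T ≤ b) : IntervalIntegrable g volume a b :=
  (hg.mono fun _ hx => (le_min ha hb).trans hx.1).intervalIntegrable

theorem hasDerivWithinAt_integral_Ici (hg : ContinuousOn g (Ici T)) {t : ℝ} (ht : T ≤ t) :
    HasDerivWithinAt (fun t => ∫ τ in T..t, g τ) (g t) (Ici T) t := by
  -- Freezing `g` at `g T` to the left of `T` gives a continuous function on the line, so the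
  -- two-sided fundamental theorem applies even at `T`.
  have hc : Continuous fun s => g (max T s) :=
    hg.comp_continuous (by fun_prop) fun s => mem_Ici.2 (le_max_left T s)
  have h := (intervalIntegral.integral_hasDerivAt_right (hc.intervalIntegrable T t)
    (hc.stronglyMeasurableAtFilter _ _) hc.continuousAt).hasDerivWithinAt (s := Ici T)
  have heq : ∀ s ≥ T, ∫ τ in T..s, g τ = ∫ τ in T..s, g (max T τ) := fun s hs =>
    intervalIntegral.integral_congr fun τ hτ => by
      rw [uIcc_of_le hs] at hτ
      simp only [max_eq_right hτ.1]
  rw [max_eq_right ht] at h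
  exact h.congr heq (heq t ht)

theorem integralTop_of_hasDerivWithinAt (hf : ∀ t ≥ T, HasDerivWithinAt f (g t) (Ici T) t)
    (hg : ContinuousOn g (Ici T)) (h : Tendsto f atTop atTop) : IntegralTop g T := by
  refine (tendsto_atTop_add_const_right atTop (-f T) h).congr' ?_
  filter_upwards [eventually_ge_atTop T] with t ht
  rw [integral_eq_sub_of_hasDerivWithinAt_Ici hf hg ht, sub_eq_add_neg]

theorem integralBot_of_hasDerivWithinAt (hf : ∀ t ≥ T, HasDerivWithinAt f (g t) (Ici T) t)
    (hg : ContinuousOn g (Ici T)) (h : Tendsto f atTop atBot) : IntegralBot g T := by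
  refine (tendsto_atBot_add_const_right atTop (-f T) h).congr' ?_
  filter_upwards [eventually_ge_atTop T] with t ht
  rw [integral_eq_sub_of_hasDerivWithinAt_Ici hf hg ht, sub_eq_add_neg]

theorem integralConv_of_hasDerivWithinAt (hf : ∀ t ≥ T, HasDerivWithinAt f (g t) (Ici T) t)
    (hg : ContinuousOn g (Ici T)) {l : ℝ} (h : Tendsto f atTop (𝓝 l)) : IntegralConv g T := by
  refine ⟨l - f T, (h.sub_const (f T)).congr' ?_⟩
  filter_upwards [eventually_ge_atTop T] with t ht
  rw [integral_eq_sub_of_hasDerivWithinAt_Ici hf hg ht]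

theorem integral_eventuallyEq_of_eqOn (h : ∀ t ≥ T, f t = g t) :
    (fun t => ∫ τ in T..t, f τ) =ᶠ[atTop] fun t => ∫ τ in T..t, g τ := by
  filter_upwards [eventually_ge_atTop T] with t ht
  refine intervalIntegral.integral_congr fun τ hτ => h τ ?_
  rw [uIcc_of_le ht] at hτ
  exact hτ.1

theorem IntegralTop.congr (hf : IntegralTop f T) (h : ∀ t ≥ T, f t = g t) : IntegralTop g T :=
  Tendsto.congr' (integral_eventuallyEq_of_eqOn h) hf

theorem IntegralBot.congr (hf : IntegralBot f T) (h : ∀ t ≥ T, f t = g t) : IntegralBot g T :=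
  Tendsto.congr' (integral_eventuallyEq_of_eqOn h) hf

theorem IntegralConv.congr (hf : IntegralConv f T) (h : ∀ t ≥ T, f t = g t) : IntegralConv g T :=
  hf.imp fun _ hL => hL.congr' (integral_eventuallyEq_of_eqOn h)

theorem IntegralConv.integral_le {L : ℝ}
    (hf : Tendsto (fun t => ∫ τ in T..t, f τ) atTop (𝓝 L)) (hc : ContinuousOn f (Ici T))
    (h0 : ∀ t ≥ T, 0 ≤ f t) {t : ℝ} (ht : T ≤ t) : ∫ τ in T..t, f τ ≤ L := by
  refine ge_of_tendsto hf ?_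
  filter_upwards [eventually_ge_atTop t] with s hs
  exact monotoneOn_of_hasDerivWithinAt_Ici (fun t ht => hasDerivWithinAt_integral_Ici hc ht) h0
    ht (ht.trans hs) hs

end HalfLine

/-! ### Planar systems without diagonal terms -/

/-- `(x, y)` solves `x' = p y`, `y' = q x` on `[t₀, ∞)`. -/
def IsOffDiagSolution (p q : ℝ → ℝ) (t₀ : ℝ) (x y : ℝ → ℝ) : Prop :=
  ∀ t ≥ t₀, HasDerivWithinAt x (p t * y t) (Ici t₀) t ∧
    HasDerivWithinAt y (q t * x t) (Ici t₀) t

/-- A continuous nonnegative function on `[t₀, ∞)` with unbounded support. -/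
structure IsAdmissible (p : ℝ → ℝ) (t₀ : ℝ) : Prop where
  cont : ContinuousOn p (Ici t₀)
  nonneg : ∀ t ≥ t₀, 0 ≤ p t
  supp : ∀ T ≥ t₀, ∃ t ≥ T, p t ≠ 0

/-- A fundamental pair of solutions with nonnegative components and unit Wronskian. -/
structure IsFundamental (p q : ℝ → ℝ) (t₀ : ℝ) (x₁ y₁ x₂ y₂ : ℝ → ℝ) : Prop where
  sol₁ : IsOffDiagSolution p q t₀ x₁ y₁
  sol₂ : IsOffDiagSolution p q t₀ x₂ y₂
  one_le_x₁ : ∀ t ≥ t₀, 1 ≤ x₁ t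
  y₁_nonneg : ∀ t ≥ t₀, 0 ≤ y₁ t
  x₂_nonneg : ∀ t ≥ t₀, 0 ≤ x₂ t
  one_le_y₂ : ∀ t ≥ t₀, 1 ≤ y₂ t
  det : ∀ t ≥ t₀, x₁ t * y₂ t - x₂ t * y₁ t = 1

variable {p q : ℝ → ℝ} {t₀ : ℝ} {x y u v x₁ y₁ x₂ y₂ : ℝ → ℝ} {α γ : ℝ}

namespace IsOffDiagSolution

theorem symm (h : IsOffDiagSolution p q t₀ x y) : IsOffDiagSolution q p t₀ y x :=
  fun t ht => (h t ht).symm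

theorem continuousOn_fst (h : IsOffDiagSolution p q t₀ x y) : ContinuousOn x (Ici t₀) :=
  fun t ht => (h t ht).1.continuousWithinAt

theorem continuousOn_snd (h : IsOffDiagSolution p q t₀ x y) : ContinuousOn y (Ici t₀) :=
  h.symm.continuousOn_fst

theorem linearComb (h : IsOffDiagSolution p q t₀ x y) (h' : IsOffDiagSolution p q t₀ u v)
    (a b : ℝ) : IsOffDiagSolution p q t₀ (fun t => a * x t + b * u t)
      (fun t => a * y t + b * v t) := by
  intro t ht
  constructor
  · convert! ((h t ht).1.const_mul a).add ((h' t ht).1.const_mul b) using 1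
    ring
  · convert! ((h t ht).2.const_mul a).add ((h' t ht).2.const_mul b) using 1
    ring

/-- The Wronskian of two solutions is constant. -/
theorem wronskian_eq (h : IsOffDiagSolution p q t₀ x y) (h' : IsOffDiagSolution p q t₀ u v)
    {t : ℝ} (ht : t₀ ≤ t) : x t * v t - u t * y t = x t₀ * v t₀ - u t₀ * y t₀ := by
  refine eq_of_hasDerivWithinAt_zero_Ici (f := fun t => x t * v t - u t * y t)
    (fun s hs => ?_) ht
  convert! ((h s hs).1.mul (h' s hs).2).sub ((h' s hs).1.mul (h s hs).2) using 1
  ring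

theorem mul_nonneg (h : IsOffDiagSolution p q t₀ x y) (hp : IsAdmissible p t₀)
    (hq : IsAdmissible q t₀) (h0 : x t₀ * y t₀ = 0) {t : ℝ} (ht : t₀ ≤ t) : 0 ≤ x t * y t := by
  have hm := monotoneOn_of_hasDerivWithinAt_Ici (f := fun t => x t * y t)
    (g := fun t => p t * y t ^ 2 + q t * x t ^ 2) (T := t₀) (fun s hs => by
      convert! (h s hs).1.mul (h s hs).2 using 1
      ring) fun s hs => by
        have := hp.nonneg s hs
        have := hq.nonneg s hs
        positivity
  simpa [h0] using hm (mem_Ici.2 le_rfl) ht ht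

/-- Since `(x ^ 2)' = 2 p x y ≥ 0`, the square of `x` stays at least 1. Thus `x` cannot change sign,
and the sign of `x y` passes to `y`. -/
theorem one_le_and_nonneg (h : IsOffDiagSolution p q t₀ x y) (hp : IsAdmissible p t₀)
    (hq : IsAdmissible q t₀) (hx0 : x t₀ = 1) (hy0 : y t₀ = 0) {t : ℝ} (ht : t₀ ≤ t) :
    1 ≤ x t ∧ 0 ≤ y t := by
  have hxy : ∀ s ≥ t₀, 0 ≤ x s * y s := fun s hs => h.mul_nonneg hp hq (by simp [hy0]) hs
  have hsq : ∀ s ≥ t₀, 1 ≤ x s ^ 2 := by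
    intro s hs
    have hm := monotoneOn_of_hasDerivWithinAt_Ici (f := fun t => x t ^ 2)
      (g := fun t => 2 * p t * (x t * y t)) (T := t₀) (fun s hs => by
        convert! (h s hs).1.pow 2 using 1
        push_cast
        ring) fun s hs =>
          _root_.mul_nonneg (_root_.mul_nonneg zero_le_two (hp.nonneg s hs)) (hxy s hs)
    simpa [hx0] using hm (mem_Ici.2 le_rfl) hs hs
  have hpos : 0 < x t := by
    by_contra! hneg
    obtain ⟨s, hs, hs0⟩ := intermediate_value_Icc' ht
      (h.continuousOn_fst.mono Icc_subset_Ici_self) (show (0 : ℝ) ∈ Icc (x t) (x t₀) from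
        ⟨hneg, by rw [hx0]; exact zero_le_one⟩)
    have := hsq s hs.1
    rw [hs0] at this
    norm_num at this
  refine ⟨by nlinarith [hsq t ht], ?_⟩
  exact nonneg_of_mul_nonneg_right (hxy t ht) hpos

end IsOffDiagSolution

theorem exists_isOffDiagSolution (hp : ContinuousOn p (Ici t₀)) (hq : ContinuousOn q (Ici t₀))
    (a b : ℝ) : ∃ x y : ℝ → ℝ, x t₀ = a ∧ y t₀ = b ∧ IsOffDiagSolution p q t₀ x y := by
  have hc : ∀ {g : ℝ → ℝ}, ContinuousOn g (Ici t₀) → Continuous fun s => g (max t₀ s) :=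
    fun hg => hg.comp_continuous (by fun_prop) fun s => mem_Ici.2 (le_max_left t₀ s)
  let A : ℝ → ℝ × ℝ →L[ℝ] ℝ × ℝ := fun t =>
    p (max t₀ t) • (ContinuousLinearMap.inl ℝ ℝ ℝ).comp (ContinuousLinearMap.snd ℝ ℝ ℝ) +
      q (max t₀ t) • (ContinuousLinearMap.inr ℝ ℝ ℝ).comp (ContinuousLinearMap.fst ℝ ℝ ℝ)
  have hA : Continuous A := ((hc hp).smul continuous_const).add ((hc hq).smul continuous_const)
  obtain ⟨z, hz0, hz⟩ := exists_linearODE_solution hA t₀ (a, b)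
  refine ⟨fun t => (z t).1, fun t => (z t).2, by simp [hz0], by simp [hz0], fun t ht => ?_⟩
  have h1 := (hasFDerivAt_fst.comp_hasDerivAt t (hz t)).hasDerivWithinAt (s := Ici t₀)
  have h2 := (hasFDerivAt_snd.comp_hasDerivAt t (hz t)).hasDerivWithinAt (s := Ici t₀)
  constructor
  · convert! h1 using 1
    simp [A, max_eq_right ht]
  · convert! h2 using 1
    simp [A, max_eq_right ht]

theorem exists_isFundamental (hp : IsAdmissible p t₀) (hq : IsAdmissible q t₀) :
    ∃ x₁ y₁ x₂ y₂, IsFundamental p q t₀ x₁ y₁ x₂ y₂ := by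
  obtain ⟨x₁, y₁, hx₁, hy₁, h₁⟩ := exists_isOffDiagSolution hp.cont hq.cont 1 0
  obtain ⟨x₂, y₂, hx₂, hy₂, h₂⟩ := exists_isOffDiagSolution hp.cont hq.cont 0 1
  have h₁' := fun t (ht : t₀ ≤ t) => h₁.one_le_and_nonneg hp hq hx₁ hy₁ ht
  have h₂' := fun t (ht : t₀ ≤ t) => h₂.symm.one_le_and_nonneg hq hp hy₂ hx₂ ht
  refine ⟨x₁, y₁, x₂, y₂, h₁, h₂, fun t ht => (h₁' t ht).1, fun t ht => (h₁' t ht).2,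
    fun t ht => (h₂' t ht).2, fun t ht => (h₂' t ht).1, fun t ht => ?_⟩
  rw [h₁.wronskian_eq h₂ ht, hx₁, hy₁, hx₂, hy₂]
  norm_num

/-- The quotient of the first components has derivative `W p / u²`. -/
theorem IsOffDiagSolution.hasDerivWithinAt_div (h : IsOffDiagSolution p q t₀ x y)
    (h' : IsOffDiagSolution p q t₀ u v) {t : ℝ} (ht : t₀ ≤ t) (hu : u t ≠ 0) :
    HasDerivWithinAt (fun t => x t / u t) ((u t₀ * y t₀ - x t₀ * v t₀) * (p t / u t ^ 2))
      (Ici t₀) t := by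
  convert! (h t ht).1.div (h' t ht).1 hu using 1
  rw [← h'.wronskian_eq h ht]
  field_simp

namespace IsFundamental

theorem swap (F : IsFundamental p q t₀ x₁ y₁ x₂ y₂) : IsFundamental q p t₀ y₂ x₂ y₁ x₁ where
  sol₁ := F.sol₂.symm
  sol₂ := F.sol₁.symm
  one_le_x₁ := F.one_le_y₂
  y₁_nonneg := F.x₂_nonneg
  x₂_nonneg := F.y₁_nonneg
  one_le_y₂ := F.one_le_x₁
  det t ht := by linarith [F.det t ht]

end IsFundamental

theorem exists_tendsto_of_monotoneOn_Ici {f : ℝ → ℝ} {T C : ℝ} (hf : MonotoneOn f (Ici T))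
    (hC : ∀ t ≥ T, f t ≤ C) : ∃ l, Tendsto f atTop (𝓝 l) ∧ ∀ t ≥ T, f t ≤ l := by
  have hm : Monotone fun t => f (max T t) := fun a b hab =>
    hf (mem_Ici.2 (le_max_left T a)) (mem_Ici.2 (le_max_left T b)) (max_le_max le_rfl hab)
  have hb : BddAbove (range fun t => f (max T t)) :=
    ⟨C, by rintro _ ⟨t, rfl⟩; exact hC _ (le_max_left T t)⟩
  refine ⟨_, (tendsto_atTop_ciSup hm hb).congr' ?_, fun t ht => ?_⟩
  · filter_upwards [eventually_ge_atTop T] with t ht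
    rw [max_eq_right ht]
  · have := le_ciSup hb t
    simpa only [max_eq_right ht] using this

/-! ### Ratios of the fundamental solutions and their limits. -/

namespace IsFundamental

theorem x₁_pos (F : IsFundamental p q t₀ x₁ y₁ x₂ y₂) {t : ℝ} (ht : t₀ ≤ t) : 0 < x₁ t :=
  zero_lt_one.trans_le (F.one_le_x₁ t ht)

theorem y₂_pos (F : IsFundamental p q t₀ x₁ y₁ x₂ y₂) {t : ℝ} (ht : t₀ ≤ t) : 0 < y₂ t :=
  F.swap.x₁_pos ht

theorem hasDerivWithinAt_ratio (F : IsFundamental p q t₀ x₁ y₁ x₂ y₂) {t : ℝ} (ht : t₀ ≤ t) :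
    HasDerivWithinAt (fun t => x₂ t / x₁ t) (p t / x₁ t ^ 2) (Ici t₀) t := by
  have := F.sol₂.hasDerivWithinAt_div F.sol₁ ht (F.x₁_pos ht).ne'
  rwa [F.det t₀ le_rfl, one_mul] at this

theorem monotoneOn_ratio (F : IsFundamental p q t₀ x₁ y₁ x₂ y₂) (hp : IsAdmissible p t₀) :
    MonotoneOn (fun t => x₂ t / x₁ t) (Ici t₀) :=
  monotoneOn_of_hasDerivWithinAt_Ici (fun _ ht => F.hasDerivWithinAt_ratio ht)
    fun t ht => div_nonneg (hp.nonneg t ht) (sq_nonneg _)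

/-- The ratio may be constant on intervals where `p` vanishes, but unbounded support forces a later
increase. This is what keeps the ratio strictly below its limit. -/
theorem exists_ratio_lt (F : IsFundamental p q t₀ x₁ y₁ x₂ y₂) (hp : IsAdmissible p t₀)
    {t : ℝ} (ht : t₀ ≤ t) : ∃ s ≥ t, x₂ t / x₁ t < x₂ s / x₁ s := by
  by_contra! hcon
  obtain ⟨s, hs, hps⟩ := hp.supp t ht
  have heq : ∀ s ∈ Ici t, x₂ s / x₁ s = x₂ t / x₁ t := fun s hs =>
    le_antisymm (hcon s hs) (F.monotoneOn_ratio hp ht (mem_Ici.2 (ht.trans hs)) hs)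
  have h1 := (F.hasDerivWithinAt_ratio (ht.trans hs)).mono (Ici_subset_Ici.2 ht)
  have h2 : HasDerivWithinAt (fun t => x₂ t / x₁ t) 0 (Ici t) s :=
    (hasDerivWithinAt_const s (Ici t) (x₂ t / x₁ t)).congr heq (heq s hs)
  have h3 := (uniqueDiffOn_Ici t s hs).eq_deriv _ h1 h2
  have hx := F.x₁_pos (ht.trans hs)
  exact hps ((div_eq_zero_iff.1 h3).resolve_right (by positivity))

theorem ratio_mul_ratio (F : IsFundamental p q t₀ x₁ y₁ x₂ y₂) {t : ℝ} (ht : t₀ ≤ t) :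
    x₂ t / x₁ t * (y₁ t / y₂ t) = 1 - 1 / (x₁ t * y₂ t) := by
  have h1 := F.x₁_pos ht
  have h2 := F.y₂_pos ht
  have h3 := F.det t ht
  field_simp
  linarith

theorem exists_y₁_pos (F : IsFundamental p q t₀ x₁ y₁ x₂ y₂) (hq : IsAdmissible q t₀) :
    ∃ T ≥ t₀, 0 < y₁ T := by
  obtain ⟨T, hT, h⟩ := F.swap.exists_ratio_lt hq le_rfl
  have h0 : 0 ≤ y₁ t₀ / y₂ t₀ := div_nonneg (F.y₁_nonneg _ le_rfl) (F.y₂_pos le_rfl).le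
  exact ⟨T, hT, (div_pos_iff_of_pos_right (F.y₂_pos hT)).1 (h0.trans_lt h)⟩

theorem exists_tendsto_ratio (F : IsFundamental p q t₀ x₁ y₁ x₂ y₂) (hp : IsAdmissible p t₀)
    (hq : IsAdmissible q t₀) : ∃ α, 0 < α ∧ Tendsto (fun t => x₂ t / x₁ t) atTop (𝓝 α) ∧
      ∀ t ≥ t₀, 0 < α * x₁ t - x₂ t := by
  obtain ⟨T, hT, hyT⟩ := F.exists_y₁_pos hq
  have hsT : 0 < y₁ T / y₂ T := div_pos hyT (F.y₂_pos hT)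
  -- The product of the two ratios is at most 1, and from `T` on the second is at least its positive
  -- value at `T`; monotonicity moves the comparison to `max t T`.
  have hbound : ∀ t ≥ t₀, x₂ t / x₁ t ≤ 1 / (y₁ T / y₂ T) := by
    intro t ht
    have hm : t₀ ≤ max t T := ht.trans (le_max_left _ _)
    refine (F.monotoneOn_ratio hp ht hm (le_max_left _ _)).trans ?_
    rw [le_div_iff₀ hsT]
    have h0 : 0 ≤ x₂ (max t T) / x₁ (max t T) := div_nonneg (F.x₂_nonneg _ hm) (F.x₁_pos hm).le
    refine (mul_le_mul_of_nonneg_left (F.swap.monotoneOn_ratio hq hT hm (le_max_right _ _))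
      h0).trans ?_
    rw [F.ratio_mul_ratio hm, sub_le_self_iff]
    have := F.x₁_pos hm
    have := F.y₂_pos hm
    positivity
  obtain ⟨α, hα, hle⟩ := exists_tendsto_of_monotoneOn_Ici (F.monotoneOn_ratio hp) hbound
  have hlt : ∀ t ≥ t₀, x₂ t / x₁ t < α := fun t ht => by
    obtain ⟨s, hs, h⟩ := F.exists_ratio_lt hp ht
    exact h.trans_le (hle s (le_trans ht hs))
  refine ⟨α, (div_nonneg (F.x₂_nonneg _ le_rfl) (F.x₁_pos le_rfl).le).trans_lt (hlt t₀ le_rfl),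
    hα, fun t ht => ?_⟩
  have := (div_lt_iff₀ (F.x₁_pos ht)).1 (hlt t ht)
  linarith

/-- Every solution is a combination of the two fundamental ones. -/
theorem eq_linearComb (F : IsFundamental p q t₀ x₁ y₁ x₂ y₂) (h : IsOffDiagSolution p q t₀ x y) :
    ∃ c d : ℝ, ∀ t ≥ t₀, x t = c * x₁ t - d * x₂ t ∧ y t = c * y₁ t - d * y₂ t := by
  -- Cramer's rule: the coefficients are Wronskians, so they may be evaluated at `t` instead of
  -- `t₀`.
  refine ⟨x t₀ * y₂ t₀ - x₂ t₀ * y t₀, x t₀ * y₁ t₀ - x₁ t₀ * y t₀, fun t ht => ?_⟩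
  rw [← h.wronskian_eq F.sol₂ ht, ← h.wronskian_eq F.sol₁ ht]
  have := F.det t ht
  constructor
  · linear_combination (-(x t)) * this
  · linear_combination (-(y t)) * this

end IsFundamental

/-- A solution with nonvanishing first component that is small compared with the first component of
every other solution. -/
structure IsPrincipal (p q : ℝ → ℝ) (t₀ : ℝ) (x y : ℝ → ℝ) : Prop where
  sol : IsOffDiagSolution p q t₀ x y
  integralTop : IntegralTop (fun t => p t / x t ^ 2) t₀
  tendsto_div : ∀ u v, IsOffDiagSolution p q t₀ u v → x t₀ * v t₀ - u t₀ * y t₀ ≠ 0 →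
    Tendsto (fun t => x t / u t) atTop (𝓝 0)

/-! ### Principal solutions from the ratio limits. -/

namespace IsFundamental

theorem tendsto_div_x₁ (F : IsFundamental p q t₀ x₁ y₁ x₂ y₂)
    (hα : Tendsto (fun t => x₂ t / x₁ t) atTop (𝓝 α)) {c d : ℝ}
    (hx : ∀ t ≥ t₀, x t = c * x₁ t - d * x₂ t) :
    Tendsto (fun t => x t / x₁ t) atTop (𝓝 (c - d * α)) := by
  refine ((hα.const_mul d).const_sub c).congr' ?_
  filter_upwards [eventually_ge_atTop t₀] with t ht
  have := F.x₁_pos ht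
  rw [hx t ht]
  field_simp

theorem wronskian_principal (F : IsFundamental p q t₀ x₁ y₁ x₂ y₂) {c d : ℝ}
    (hxy : ∀ t ≥ t₀, x t = c * x₁ t - d * x₂ t ∧ y t = c * y₁ t - d * y₂ t) (k : ℝ) :
    k * (α * x₁ t₀ - x₂ t₀) * y t₀ - x t₀ * (k * (α * y₁ t₀ - y₂ t₀)) = k * (c - d * α) := by
  rw [(hxy t₀ le_rfl).1, (hxy t₀ le_rfl).2]
  linear_combination (k * (c - d * α)) * F.det t₀ le_rfl

theorem eventually_ne (F : IsFundamental p q t₀ x₁ y₁ x₂ y₂) (hp : IsAdmissible p t₀)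
    (hq : IsAdmissible q t₀) (h : IsOffDiagSolution p q t₀ x y)
    (h0 : ¬ (x t₀ = 0 ∧ y t₀ = 0)) : ∀ᶠ t in atTop, x t ≠ 0 := by
  obtain ⟨α, -, hα, hpos⟩ := F.exists_tendsto_ratio hp hq
  obtain ⟨c, d, hcd⟩ := F.eq_linearComb h
  by_cases hc : c - d * α = 0
  · have hd : d ≠ 0 := by
      rintro rfl
      obtain rfl : c = 0 := by simpa using hc
      exact h0 (by simpa using hcd t₀ le_rfl)
    filter_upwards [eventually_ge_atTop t₀] with t ht
    rw [(hcd t ht).1, show c * x₁ t - d * x₂ t = d * (α * x₁ t - x₂ t) by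
      linear_combination x₁ t * hc]
    exact mul_ne_zero hd (hpos t ht).ne'
  · filter_upwards [(F.tendsto_div_x₁ hα fun t ht => (hcd t ht).1).eventually_ne hc] with t ht hx
    simp [hx] at ht

theorem isPrincipal (F : IsFundamental p q t₀ x₁ y₁ x₂ y₂) (hp : IsAdmissible p t₀)
    (hα : Tendsto (fun t => x₂ t / x₁ t) atTop (𝓝 α)) (hpos : ∀ t ≥ t₀, 0 < α * x₁ t - x₂ t)
    {k : ℝ} (hk : k ≠ 0) : IsPrincipal p q t₀ (fun t => k * (α * x₁ t - x₂ t))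
      (fun t => k * (α * y₁ t - y₂ t)) := by
  have hsol : IsOffDiagSolution p q t₀ (fun t => k * (α * x₁ t - x₂ t))
      (fun t => k * (α * y₁ t - y₂ t)) := by
    convert! F.sol₁.linearComb F.sol₂ (k * α) (-k) using 2 <;> ring
  have hzero : Tendsto (fun t => (α * x₁ t - x₂ t) / x₁ t) atTop (𝓝 0) := by
    have := F.tendsto_div_x₁ (x := fun t => α * x₁ t - x₂ t) hα (c := α) (d := 1)
      fun t _ => by ring
    simpa using this
  have hne : ∀ t ≥ t₀, k * (α * x₁ t - x₂ t) ≠ 0 := fun t ht => mul_ne_zero hk (hpos t ht).ne'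
  refine ⟨hsol, ?_, fun u v h hW => ?_⟩
  -- The Wronskian with `(x₁, y₁)` is `k`, so this quotient is a primitive of the weight. It is the
  -- reciprocal of a positive quantity tending to 0, up to the factor `k⁻¹ * k⁻¹ > 0`.
  · refine integralTop_of_hasDerivWithinAt (f := fun t => k⁻¹ * (x₁ t / (k * (α * x₁ t - x₂ t))))
      (fun t ht => ?_) ?_ ?_
    · convert! (F.sol₁.hasDerivWithinAt_div hsol ht (hne t ht)).const_mul k⁻¹ using 1
      rw [F.wronskian_principal (c := 1) (d := 0) (fun t _ => by simp) k]
      field_simp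
      ring
    · exact hp.cont.div (hsol.continuousOn_fst.pow 2) fun t ht => pow_ne_zero 2 (hne t ht)
    · have h1 : Tendsto (fun t => (α * x₁ t - x₂ t) / x₁ t) atTop (𝓝[>] 0) := by
        refine tendsto_nhdsWithin_iff.2 ⟨hzero, ?_⟩
        filter_upwards [eventually_ge_atTop t₀] with t ht
        exact div_pos (hpos t ht) (F.x₁_pos ht)
      refine (h1.inv_tendsto_nhdsGT_zero.const_mul_atTop
        (show 0 < k⁻¹ * k⁻¹ from mul_self_pos.2 (inv_ne_zero hk))).congr' ?_
      filter_upwards [eventually_ge_atTop t₀] with t ht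
      have := hpos t ht
      simp only [Pi.inv_apply]
      field_simp
  · obtain ⟨c, d, hcd⟩ := F.eq_linearComb h
    rw [F.wronskian_principal hcd k] at hW
    have h1 := F.tendsto_div_x₁ hα fun t ht => (hcd t ht).1
    have h2 := (hzero.const_mul k).div h1 (right_ne_zero_of_mul hW)
    rw [mul_zero, zero_div] at h2
    refine h2.congr' ?_
    filter_upwards [eventually_ge_atTop t₀] with t ht
    have := F.x₁_pos ht
    simp only [Pi.div_apply]
    field_simp

/-- Once `y₁` is positive at `T` it stays at least `y₁ T`, so `x₁' ≥ y₁ T * p` and `x₁` grows at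
least like `∫ p`. -/
theorem tendsto_x₁_atTop (F : IsFundamental p q t₀ x₁ y₁ x₂ y₂) (hp : IsAdmissible p t₀)
    (hq : IsAdmissible q t₀) (htop : IntegralTop p t₀) : Tendsto x₁ atTop atTop := by
  obtain ⟨T, hT, hyT⟩ := F.exists_y₁_pos hq
  have hy : MonotoneOn y₁ (Ici t₀) := monotoneOn_of_hasDerivWithinAt_Ici
    (fun t ht => (F.sol₁ t ht).2)
    fun t ht => mul_nonneg (hq.nonneg t ht) (F.x₁_pos ht).le
  have hm := monotoneOn_of_hasDerivWithinAt_Ici (T := T)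
    (f := fun t => x₁ t - y₁ T * ∫ τ in t₀..t, p τ) (g := fun t => p t * y₁ t - y₁ T * p t)
    (fun t ht => (((F.sol₁ t (le_trans hT ht)).1).sub
      ((hasDerivWithinAt_integral_Ici hp.cont (le_trans hT ht)).const_mul _)).mono
      (Ici_subset_Ici.2 hT)) fun t ht => by
        have h1 := hy hT (mem_Ici.2 (le_trans hT ht)) ht
        nlinarith [hp.nonneg t (le_trans hT ht)]
  refine tendsto_atTop_mono' _ ?_ (tendsto_atTop_add_const_left atTop
    (x₁ T - y₁ T * ∫ τ in t₀..T, p τ) (Tendsto.const_mul_atTop hyT htop))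
  filter_upwards [eventually_ge_atTop T] with t ht
  have := hm (mem_Ici.2 le_rfl) (mem_Ici.2 ht) ht
  simp only at this
  linarith

/-- `Real.log` is the logarithm of the absolute value, so no sign of `x` is needed: `x / x₁` has a
nonzero limit and `x₁ → ∞`. -/
theorem tendsto_log_atTop (F : IsFundamental p q t₀ x₁ y₁ x₂ y₂)
    (hα : Tendsto (fun t => x₂ t / x₁ t) atTop (𝓝 α)) (htop : Tendsto x₁ atTop atTop)
    (h : IsOffDiagSolution p q t₀ x y) {k : ℝ}
    (hW : k * (α * x₁ t₀ - x₂ t₀) * y t₀ - x t₀ * (k * (α * y₁ t₀ - y₂ t₀)) ≠ 0) :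
    Tendsto (fun t => Real.log (x t)) atTop atTop := by
  obtain ⟨c, d, hcd⟩ := F.eq_linearComb h
  rw [F.wronskian_principal hcd] at hW
  have h1 := (F.tendsto_div_x₁ hα fun t ht => (hcd t ht).1).abs
  have h2 := Real.tendsto_log_atTop.comp
    (h1.pos_mul_atTop (abs_pos.2 (right_ne_zero_of_mul hW)) htop)
  refine h2.congr' ?_
  filter_upwards [eventually_ge_atTop t₀] with t ht
  have := F.x₁_pos ht
  rw [Function.comp_apply, ← Real.log_abs (x t), abs_div, abs_of_pos this]
  congr 1
  field_simp

theorem tendsto_ratio_mul_ratio (hα : Tendsto (fun t => x₂ t / x₁ t) atTop (𝓝 α))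
    (hγ : Tendsto (fun t => y₁ t / y₂ t) atTop (𝓝 γ))
    (F : IsFundamental p q t₀ x₁ y₁ x₂ y₂) :
    Tendsto (fun t => 1 - 1 / (x₁ t * y₂ t)) atTop (𝓝 (α * γ)) := by
  refine (hα.mul hγ).congr' ?_
  filter_upwards [eventually_ge_atTop t₀] with t ht
  exact F.ratio_mul_ratio ht

theorem mul_eq_one_of_integralTop (F : IsFundamental p q t₀ x₁ y₁ x₂ y₂)
    (hp : IsAdmissible p t₀) (hq : IsAdmissible q t₀)
    (hα : Tendsto (fun t => x₂ t / x₁ t) atTop (𝓝 α))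
    (hγ : Tendsto (fun t => y₁ t / y₂ t) atTop (𝓝 γ)) (htop : IntegralTop p t₀) :
    α * γ = 1 := by
  have h1 : Tendsto (fun t => x₁ t * y₂ t) atTop atTop := by
    refine tendsto_atTop_mono' _ ?_ (F.tendsto_x₁_atTop hp hq htop)
    filter_upwards [eventually_ge_atTop t₀] with t ht
    exact le_mul_of_one_le_right (F.x₁_pos ht).le (F.one_le_y₂ t ht)
  have h2 := (h1.inv_tendsto_atTop).const_sub 1
  rw [sub_zero] at h2
  refine tendsto_nhds_unique (tendsto_ratio_mul_ratio hα hγ F) (h2.congr fun t => ?_)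
  simp

/-- Grönwall for the sum: the logarithmic derivative of `x₁ + y₁` is at most `p + q`. -/
theorem exists_x₁_le (F : IsFundamental p q t₀ x₁ y₁ x₂ y₂)
    (hp : IsAdmissible p t₀) (hq : IsAdmissible q t₀)
    (hpc : IntegralConv p t₀) (hqc : IntegralConv q t₀) : ∃ C, ∀ t ≥ t₀, x₁ t ≤ C := by
  obtain ⟨P, hP⟩ := hpc
  obtain ⟨Q, hQ⟩ := hqc
  have hpos : ∀ t ≥ t₀, 0 < x₁ t + y₁ t := fun t ht =>
    add_pos_of_pos_of_nonneg (F.x₁_pos ht) (F.y₁_nonneg t ht)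
  have hm := antitoneOn_of_hasDerivWithinAt_Ici (T := t₀)
    (f := fun t => Real.log (x₁ t + y₁ t) - ((∫ τ in t₀..t, p τ) + ∫ τ in t₀..t, q τ))
    (g := fun t => (p t * y₁ t + q t * x₁ t) / (x₁ t + y₁ t) - (p t + q t))
    (fun t ht => (((F.sol₁ t ht).1.add (F.sol₁ t ht).2).log (hpos t ht).ne').sub
      ((hasDerivWithinAt_integral_Ici hp.cont ht).add (hasDerivWithinAt_integral_Ici hq.cont ht)))
    fun t ht => by
      rw [sub_nonpos, div_le_iff₀ (hpos t ht)]
      nlinarith [mul_nonneg (hp.nonneg t ht) (F.x₁_pos ht).le,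
        mul_nonneg (hq.nonneg t ht) (F.y₁_nonneg t ht)]
  refine ⟨Real.exp (Real.log (x₁ t₀ + y₁ t₀) + (P + Q)), fun t ht => ?_⟩
  have h1 := hm (mem_Ici.2 le_rfl) (mem_Ici.2 ht) ht
  simp only [intervalIntegral.integral_same, add_zero, sub_zero] at h1
  have h2 := IntegralConv.integral_le hP hp.cont hp.nonneg ht
  have h3 := IntegralConv.integral_le hQ hq.cont hq.nonneg ht
  have h4 : x₁ t + y₁ t ≤ Real.exp (Real.log (x₁ t₀ + y₁ t₀) + (P + Q)) := by
    rw [← Real.log_le_iff_le_exp (hpos t ht)]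
    linarith
  linarith [F.y₁_nonneg t ht]

theorem mul_lt_one_of_integralConv (F : IsFundamental p q t₀ x₁ y₁ x₂ y₂)
    (hp : IsAdmissible p t₀) (hq : IsAdmissible q t₀)
    (hα : Tendsto (fun t => x₂ t / x₁ t) atTop (𝓝 α))
    (hγ : Tendsto (fun t => y₁ t / y₂ t) atTop (𝓝 γ))
    (hpc : IntegralConv p t₀) (hqc : IntegralConv q t₀) : α * γ < 1 := by
  obtain ⟨C, hC⟩ := F.exists_x₁_le hp hq hpc hqc
  obtain ⟨D, hD⟩ := F.swap.exists_x₁_le hq hp hqc hpc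
  have hC0 : 0 < C := (F.x₁_pos le_rfl).trans_le (hC t₀ le_rfl)
  have hD0 : 0 < D := (F.y₂_pos le_rfl).trans_le (hD t₀ le_rfl)
  have hCD : α * γ ≤ 1 - 1 / (C * D) := by
    refine le_of_tendsto (tendsto_ratio_mul_ratio hα hγ F) ?_
    filter_upwards [eventually_ge_atTop t₀] with t ht
    have h1 := F.x₁_pos ht
    have h2 := F.y₂_pos ht
    have := hC t ht
    have := hD t ht
    gcongr
  have : 0 < 1 / (C * D) := by positivity
  linarith

end IsFundamental

theorem IsPrincipal.integralConv (h : IsPrincipal p q t₀ x y) (hp : IsAdmissible p t₀)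
    (h' : IsOffDiagSolution p q t₀ u v) (hW : x t₀ * v t₀ - u t₀ * y t₀ ≠ 0) {T : ℝ}
    (hT : t₀ ≤ T) (hu : ∀ t ≥ T, u t ≠ 0) : IntegralConv (fun t => p t / u t ^ 2) T := by
  have hW' : u t₀ * y t₀ - x t₀ * v t₀ ≠ 0 := by
    rw [← neg_ne_zero, neg_sub]
    exact hW
  refine integralConv_of_hasDerivWithinAt
    (f := fun t => (u t₀ * y t₀ - x t₀ * v t₀)⁻¹ * (x t / u t)) (fun t ht => ?_) ?_
    ((h.tendsto_div u v h' hW).const_mul _)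
  · convert! ((h.sol.hasDerivWithinAt_div h' (le_trans hT ht) (hu t ht)).mono
      (Ici_subset_Ici.2 hT)).const_mul (u t₀ * y t₀ - x t₀ * v t₀)⁻¹ using 1
    rw [inv_mul_cancel_left₀ hW']
  · exact (hp.cont.mono (Ici_subset_Ici.2 hT)).div
      ((h'.continuousOn_fst.mono (Ici_subset_Ici.2 hT)).pow 2) fun t ht => pow_ne_zero 2 (hu t ht)

/-- A solution that is small compared with a principal solution is proportional to it. -/
theorem IsPrincipal.wronskian_eq_zero (h : IsPrincipal p q t₀ x y)
    (h' : IsOffDiagSolution p q t₀ u v) (hx : ∀ᶠ t in atTop, x t ≠ 0)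
    (hu : ∀ᶠ t in atTop, u t ≠ 0)
    (hlim : x t₀ * v t₀ - u t₀ * y t₀ ≠ 0 → Tendsto (fun t => u t / x t) atTop (𝓝 0)) :
    x t₀ * v t₀ - u t₀ * y t₀ = 0 := by
  by_contra hW
  have h1 := (h.tendsto_div u v h' hW).mul (hlim hW)
  have h2 : Tendsto (fun t => x t / u t * (u t / x t)) atTop (𝓝 1) := by
    refine tendsto_const_nhds.congr' ?_
    filter_upwards [hx, hu] with t h1 h2
    field_simp
  have := tendsto_nhds_unique h1 h2
  norm_num at this

/-! ### Solutions with components of opposite signs -/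

namespace IsOffDiagSolution

/-- The component `y` increases to some `l ≤ 0`. If `l < 0`, then `x' ≤ l p` drives `x` below 0. -/
theorem tendsto_zero_of_integralTop (h : IsOffDiagSolution p q t₀ x y) (hp : IsAdmissible p t₀)
    (hq : IsAdmissible q t₀) (hx : ∀ t ≥ t₀, 0 < x t) (hy : ∀ t ≥ t₀, y t < 0)
    (htop : IntegralTop p t₀) : Tendsto y atTop (𝓝 0) := by
  have hm : MonotoneOn y (Ici t₀) := monotoneOn_of_hasDerivWithinAt_Ici (fun t ht => (h t ht).2)
    fun t ht => _root_.mul_nonneg (hq.nonneg t ht) (hx t ht).le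
  obtain ⟨l, hl, hle⟩ := exists_tendsto_of_monotoneOn_Ici hm fun t ht => (hy t ht).le
  have hl0 : l ≤ 0 := le_of_tendsto hl <| by
    filter_upwards [eventually_ge_atTop t₀] with t ht
    exact (hy t ht).le
  rcases hl0.eq_or_lt with rfl | hl0
  · exact hl
  exfalso
  have ha := antitoneOn_of_hasDerivWithinAt_Ici (T := t₀)
    (f := fun t => x t - l * ∫ τ in t₀..t, p τ) (g := fun t => p t * y t - l * p t)
    (fun t ht => (h t ht).1.sub ((hasDerivWithinAt_integral_Ici hp.cont ht).const_mul _))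
    fun t ht => by nlinarith [hp.nonneg t ht, hle t ht]
  obtain ⟨t, ht, hPt⟩ := ((eventually_ge_atTop t₀).and
    ((Tendsto.const_mul_atTop (neg_pos.2 hl0) htop).eventually_ge_atTop (x t₀))).exists
  have h1 := ha (mem_Ici.2 le_rfl) (mem_Ici.2 ht) ht
  simp only [intervalIntegral.integral_same, mul_zero, sub_zero] at h1
  linarith [hx t ht]

theorem hasDerivWithinAt_log (h : IsOffDiagSolution p q t₀ x y) {T : ℝ} (hT : t₀ ≤ T)
    (hx : ∀ t ≥ T, x t ≠ 0) : ∀ t ≥ T,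
      HasDerivWithinAt (fun t => Real.log (x t)) (p t * (y t / x t)) (Ici T) t := by
  intro t ht
  convert! ((h t (le_trans hT ht)).1.mono (Ici_subset_Ici.2 hT)).log (hx t ht) using 1
  ring

theorem continuousOn_log_deriv (h : IsOffDiagSolution p q t₀ x y) (hp : IsAdmissible p t₀) {T : ℝ}
    (hT : t₀ ≤ T) (hx : ∀ t ≥ T, x t ≠ 0) : ContinuousOn (fun t => p t * (y t / x t)) (Ici T) :=
  (hp.cont.mono (Ici_subset_Ici.2 hT)).mul
    ((h.continuousOn_snd.mono (Ici_subset_Ici.2 hT)).div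
      (h.continuousOn_fst.mono (Ici_subset_Ici.2 hT)) hx)

theorem integralTop_log_deriv (h : IsOffDiagSolution p q t₀ x y) (hp : IsAdmissible p t₀) {T : ℝ}
    (hT : t₀ ≤ T) (hx : ∀ t ≥ T, x t ≠ 0)
    (hlog : Tendsto (fun t => Real.log (x t)) atTop atTop) :
    IntegralTop (fun t => p t * (y t / x t)) T :=
  integralTop_of_hasDerivWithinAt (h.hasDerivWithinAt_log hT hx)
    (h.continuousOn_log_deriv hp hT hx) hlog

theorem integralBot_of_integralTop (h : IsOffDiagSolution p q t₀ x y) (hp : IsAdmissible p t₀)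
    (hq : IsAdmissible q t₀) (hx : ∀ t ≥ t₀, 0 < x t) (hy : ∀ t ≥ t₀, y t < 0)
    (htop : IntegralTop p t₀) : IntegralBot (fun t => q t * (x t / y t)) t₀ := by
  have hy' : ∀ t ≥ t₀, y t ≠ 0 := fun t ht => (hy t ht).ne
  refine integralBot_of_hasDerivWithinAt (h.symm.hasDerivWithinAt_log le_rfl hy')
    (h.symm.continuousOn_log_deriv hq le_rfl hy') ?_
  refine Real.tendsto_log_nhdsNE_zero.comp (tendsto_nhdsWithin_iff.2
    ⟨h.tendsto_zero_of_integralTop hp hq hx hy htop, ?_⟩)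
  filter_upwards [eventually_ge_atTop t₀] with t ht
  exact hy' t ht

theorem integralConv_of_integralConv (h : IsOffDiagSolution p q t₀ x y) (hp : IsAdmissible p t₀)
    (hq : IsAdmissible q t₀) (hx : ∀ t ≥ t₀, 0 < x t) (hy : ∀ t ≥ t₀, y t < 0)
    (htop : IntegralTop p t₀) (hconv : IntegralConv (fun t => q t * ∫ τ in t₀..t, p τ) t₀) :
    IntegralConv (fun t => p t * |y t / x t|) t₀ := by
  obtain ⟨K, hK⟩ := hconv
  set P : ℝ → ℝ := fun t => ∫ τ in t₀..t, p τ with hPdef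
  have hPd : ∀ t ≥ t₀, HasDerivWithinAt P (p t) (Ici t₀) t := fun t ht =>
    hasDerivWithinAt_integral_Ici hp.cont ht
  have hPm : MonotoneOn P (Ici t₀) := monotoneOn_of_hasDerivWithinAt_Ici hPd hp.nonneg
  have hP0 : ∀ t ≥ t₀, 0 ≤ P t := fun t ht => by
    simpa [hPdef] using hPm (mem_Ici.2 le_rfl) (mem_Ici.2 ht) ht
  have hqP : ContinuousOn (fun t => q t * P t) (Ici t₀) :=
    hq.cont.mul (continuousOn_of_hasDerivWithinAt_Ici hPd)
  have hqP0 : ∀ t ≥ t₀, 0 ≤ q t * P t := fun t ht =>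
    _root_.mul_nonneg (hq.nonneg t ht) (hP0 t ht)
  set G : ℝ → ℝ := fun t => ∫ τ in t₀..t, q τ * P τ with hGdef
  have hGd : ∀ t ≥ t₀, HasDerivWithinAt G (q t * P t) (Ici t₀) t := fun t ht =>
    hasDerivWithinAt_integral_Ici hqP ht
  have hGm : MonotoneOn G (Ici t₀) := monotoneOn_of_hasDerivWithinAt_Ici hGd hqP0
  have hG0 : ∀ t ≥ t₀, 0 ≤ G t := fun t ht => by
    simpa [hGdef] using hGm (mem_Ici.2 le_rfl) (mem_Ici.2 ht) ht
  have hGK : ∀ t ≥ t₀, G t ≤ K := fun t ht => IntegralConv.integral_le hK hqP hqP0 ht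
  have hK0 : 0 ≤ K := (hG0 t₀ le_rfl).trans (hGK t₀ le_rfl)
  have hxa : AntitoneOn x (Ici t₀) := antitoneOn_of_hasDerivWithinAt_Ici (fun t ht => (h t ht).1)
    fun t ht => mul_nonpos_of_nonneg_of_nonpos (hp.nonneg t ht) (hy t ht).le
  -- As `y → 0`, `-y t` is the integral of `q x` over `[t, ∞)`. There `P t * x s ≤ P s * x t`,
  -- because `P` increases and `x` decreases, so the tail is controlled by `x t` times the integral
  -- of `q P`.
  have hPy : ∀ t ≥ t₀, -(P t * y t) ≤ K * x t := by
    intro t ht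
    have hm := monotoneOn_of_hasDerivWithinAt_Ici (T := t) (f := fun s => x t * G s - P t * y s)
      (g := fun s => x t * (q s * P s) - P t * (q s * x s))
      (fun s hs => (((hGd s (le_trans ht hs)).const_mul _).sub
        ((h s (le_trans ht hs)).2.const_mul _)).mono (Ici_subset_Ici.2 ht)) fun s hs => by
          have hs' : t₀ ≤ s := le_trans ht hs
          have h1 := hPm (mem_Ici.2 ht) (mem_Ici.2 hs') hs
          have h2 := hxa (mem_Ici.2 ht) (mem_Ici.2 hs') hs
          have h3 : P t * x s ≤ P s * x t :=
            mul_le_mul h1 h2 (hx s hs').le (hP0 s hs')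
          nlinarith [hq.nonneg s hs']
    have hlim := ((h.tendsto_zero_of_integralTop hp hq hx hy htop).const_mul (P t)).const_sub
      (x t * K)
    have h1 : x t * G t - P t * y t ≤ x t * K - P t * 0 := by
      refine ge_of_tendsto hlim ?_
      filter_upwards [eventually_ge_atTop t] with s hs
      refine (hm (mem_Ici.2 le_rfl) (mem_Ici.2 hs) hs).trans ?_
      have := mul_le_mul_of_nonneg_left (hGK s (le_trans ht hs)) (hx t ht).le
      simp only
      linarith
    have h2 := _root_.mul_nonneg (hx t ht).le (hG0 t ht)
    linarith
  -- The terms in `p y` cancel in `w' = -q P x`. As `w ≥ x`, the logarithm of `w` loses at most `∫ q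
  -- P ≤ K`; since `w ≤ (1 + K) x`, this bounds `log x` below.
  set w : ℝ → ℝ := fun t => x t - P t * y t with hwdef
  have hxw : ∀ t ≥ t₀, x t ≤ w t := fun t ht => by
    have := mul_nonpos_of_nonneg_of_nonpos (hP0 t ht) (hy t ht).le
    simp only [hwdef]
    linarith
  have hw0 : ∀ t ≥ t₀, 0 < w t := fun t ht => (hx t ht).trans_le (hxw t ht)
  have hwm := monotoneOn_of_hasDerivWithinAt_Ici (T := t₀) (f := fun t => Real.log (w t) + G t)
    (g := fun t => -(q t * P t * x t) / w t + q t * P t) (fun t ht => by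
      have hd : HasDerivWithinAt w (-(q t * P t * x t)) (Ici t₀) t := by
        convert! (h t ht).1.sub ((hPd t ht).mul (h t ht).2) using 1
        ring
      exact (hd.log (hw0 t ht).ne').add (hGd t ht)) fun t ht => by
        have h1 := mul_le_mul_of_nonneg_left (hxw t ht) (hqP0 t ht)
        rw [neg_div, neg_add_eq_sub, sub_nonneg, div_le_iff₀ (hw0 t ht)]
        exact h1
  have hlow : ∀ t ≥ t₀, -Real.log (x t) ≤ Real.log (1 + K) - Real.log (w t₀) + K := by
    intro t ht
    have h1 := hwm (mem_Ici.2 le_rfl) (mem_Ici.2 ht) ht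
    have h2 : w t ≤ (1 + K) * x t := by
      have := hPy t ht
      simp only [hwdef]
      linarith
    have h3 := Real.log_le_log (hw0 t ht) h2
    rw [Real.log_mul (by positivity) (hx t ht).ne'] at h3
    simp only at h1
    linarith [hGK t ht, hG0 t₀ le_rfl]
  have hx' : ∀ t ≥ t₀, x t ≠ 0 := fun t ht => (hx t ht).ne'
  have hd : ∀ t ≥ t₀, HasDerivWithinAt (fun t => -Real.log (x t)) (p t * |y t / x t|)
      (Ici t₀) t := fun t ht => by
    convert! (h.hasDerivWithinAt_log le_rfl hx' t ht).neg using 1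
    rw [abs_of_neg (div_neg_of_neg_of_pos (hy t ht) (hx t ht)), mul_neg]
  obtain ⟨l, hl, -⟩ := exists_tendsto_of_monotoneOn_Ici (monotoneOn_of_hasDerivWithinAt_Ici hd
    fun t ht => _root_.mul_nonneg (hp.nonneg t ht) (abs_nonneg _)) hlow
  refine integralConv_of_hasDerivWithinAt hd ?_ hl
  exact hp.cont.mul ((h.continuousOn_snd.div h.continuousOn_fst hx').abs)

end IsOffDiagSolution

/-! ### Principal solutions in the divergent and convergent cases. -/

theorem IsOffDiagSolution.exists_eq_mul (h : IsOffDiagSolution p q t₀ x y)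
    (h' : IsOffDiagSolution p q t₀ u v) (hp : IsAdmissible p t₀) (hq : IsAdmissible q t₀)
    (hx : x t₀ ≠ 0) (hW : x t₀ * v t₀ - u t₀ * y t₀ = 0) :
    ∃ c : ℝ, ∀ t ≥ t₀, u t = c * x t ∧ v t = c * y t := by
  obtain ⟨x₁, y₁, x₂, y₂, F⟩ := exists_isFundamental hp hq
  -- This difference vanishes at `t₀`, so its Wronskians with the fundamental pair are zero, and
  -- unit determinant makes it vanish identically.
  have hz := h'.linearComb h 1 (-(u t₀ / x t₀))
  have hz1 : 1 * u t₀ + -(u t₀ / x t₀) * x t₀ = 0 := by field_simp; ring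
  have hz2 : 1 * v t₀ + -(u t₀ / x t₀) * y t₀ = 0 := by field_simp; linarith
  refine ⟨u t₀ / x t₀, fun t ht => ?_⟩
  have hc := hz.wronskian_eq F.sol₂ ht
  have hd := hz.wronskian_eq F.sol₁ ht
  rw [hz1, hz2] at hc hd
  have := F.det t ht
  constructor
  · linear_combination (-(u t - u t₀ / x t₀ * x t)) * this + x₁ t * hc - x₂ t * hd
  · linear_combination (-(v t - u t₀ / x t₀ * y t)) * this + y₁ t * hc - y₂ t * hd

theorem exists_principal_of_integralTop (hp : IsAdmissible p t₀) (hq : IsAdmissible q t₀)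
    (htop : IntegralTop p t₀ ∨ IntegralTop q t₀) :
    ∃ x y, IsPrincipal p q t₀ x y ∧ IsPrincipal q p t₀ y x ∧ (∀ t ≥ t₀, 0 < x t ∧ y t < 0) ∧
      (∀ u v, IsOffDiagSolution p q t₀ u v → (∀ t ≥ t₀, 0 < u t ∧ v t < 0) →
        x t₀ * v t₀ - u t₀ * y t₀ = 0) ∧
      (∀ u v, IsOffDiagSolution p q t₀ u v → x t₀ * v t₀ - u t₀ * y t₀ ≠ 0 →
        (IntegralTop p t₀ → Tendsto (fun t => Real.log (u t)) atTop atTop) ∧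
        (IntegralTop q t₀ → Tendsto (fun t => Real.log (v t)) atTop atTop)) := by
  obtain ⟨x₁, y₁, x₂, y₂, F⟩ := exists_isFundamental hp hq
  obtain ⟨α, hα0, hα, hαpos⟩ := F.exists_tendsto_ratio hp hq
  obtain ⟨γ, hγ0, hγ, hγpos⟩ := F.swap.exists_tendsto_ratio hq hp
  have hαγ : α * γ = 1 := by
    rcases htop with h | h
    · exact F.mul_eq_one_of_integralTop hp hq hα hγ h
    · rw [mul_comm]
      exact F.swap.mul_eq_one_of_integralTop hq hp hγ hα h
  -- With `α γ = 1`, the multiple `k = 1` of the first principal solution is the multiple `k = -α`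
  -- of the second; the factor 1 keeps the shape used by `isPrincipal`.
  have hx : (fun t => 1 * (α * x₁ t - x₂ t)) = fun t => -α * (γ * x₂ t - x₁ t) :=
    funext fun t => by linear_combination x₂ t * hαγ
  have hy : (fun t => 1 * (α * y₁ t - y₂ t)) = fun t => -α * (γ * y₂ t - y₁ t) :=
    funext fun t => by linear_combination y₂ t * hαγ
  refine ⟨fun t => 1 * (α * x₁ t - x₂ t), fun t => 1 * (α * y₁ t - y₂ t),
    F.isPrincipal hp hα hαpos one_ne_zero, ?_, fun t ht => ⟨?_, ?_⟩, fun u v h huv => ?_,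
    fun u v h hW => ⟨fun hP => F.tendsto_log_atTop hα (F.tendsto_x₁_atTop hp hq hP) h hW,
      fun hQ => ?_⟩⟩
  · rw [hx, hy]
    exact F.swap.isPrincipal hq hγ hγpos (neg_ne_zero.2 hα0.ne')
  · simpa only [one_mul] using hαpos t ht
  · change 1 * (α * y₁ t - y₂ t) < 0
    rw [show 1 * (α * y₁ t - y₂ t) = -α * (γ * y₂ t - y₁ t) from congrFun hy t]
    exact mul_neg_of_neg_of_pos (neg_neg_of_pos hα0) (hγpos t ht)
  · obtain ⟨c, d, hcd⟩ := F.eq_linearComb h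
    -- The sign of each component fixes the sign of its limiting ratio. With `α γ = 1` the two
    -- inequalities are opposite, so `c - d * α`, which is the Wronskian, is zero.
    have h1 : 0 ≤ c - d * α := by
      refine ge_of_tendsto (F.tendsto_div_x₁ hα fun t ht => (hcd t ht).1) ?_
      filter_upwards [eventually_ge_atTop t₀] with t ht
      exact (div_pos (huv t ht).1 (F.x₁_pos ht)).le
    have h2 : -d - (-c) * γ ≤ 0 := by
      refine le_of_tendsto (F.swap.tendsto_div_x₁ (x := v) (c := -d) (d := -c) hγ
        fun t ht => by rw [(hcd t ht).2]; ring) ?_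
      filter_upwards [eventually_ge_atTop t₀] with t ht
      exact (div_neg_of_neg_of_pos (huv t ht).2 (F.y₂_pos ht)).le
    have h3 := F.wronskian_principal (α := α) hcd 1
    have h4 : c - d * α ≤ 0 := by
      have := mul_nonpos_of_nonneg_of_nonpos hα0.le h2
      linear_combination this - c * hαγ
    rw [h3]
    linarith
  · refine F.swap.tendsto_log_atTop hγ (F.swap.tendsto_x₁_atTop hq hp hQ) h.symm (k := -α) ?_
    contrapose! hW
    have hx0 : 1 * (α * x₁ t₀ - x₂ t₀) = _ := congrFun hx t₀
    have hy0 : 1 * (α * y₁ t₀ - y₂ t₀) = _ := congrFun hy t₀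
    rw [hx0, hy0]
    linarith

theorem exists_principal_of_integralConv (hp : IsAdmissible p t₀) (hq : IsAdmissible q t₀)
    (hpc : IntegralConv p t₀) (hqc : IntegralConv q t₀) :
    ∃ x y u v, IsPrincipal p q t₀ x y ∧ IsPrincipal q p t₀ v u ∧
      x t₀ * v t₀ - u t₀ * y t₀ ≠ 0 ∧ ∀ t ≥ t₀, 0 < x t ∧ 0 < v t := by
  obtain ⟨x₁, y₁, x₂, y₂, F⟩ := exists_isFundamental hp hq
  obtain ⟨α, hα0, hα, hαpos⟩ := F.exists_tendsto_ratio hp hq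
  obtain ⟨γ, hγ0, hγ, hγpos⟩ := F.swap.exists_tendsto_ratio hq hp
  have hαγ := F.mul_lt_one_of_integralConv hp hq hα hγ hpc hqc
  refine ⟨_, _, _, _, F.isPrincipal hp hα hαpos one_ne_zero,
    F.swap.isPrincipal hq hγ hγpos one_ne_zero, ?_, fun t ht => ⟨?_, ?_⟩⟩
  · have : 1 * (α * x₁ t₀ - x₂ t₀) * (1 * (γ * y₂ t₀ - y₁ t₀)) -
        1 * (γ * x₂ t₀ - x₁ t₀) * (1 * (α * y₁ t₀ - y₂ t₀)) = α * γ - 1 := by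
      linear_combination (α * γ - 1) * F.det t₀ le_rfl
    rw [this]
    exact (sub_neg.2 hαγ).ne
  · rw [one_mul]
    exact hαpos t ht
  · rw [one_mul]
    exact hγpos t ht

/-! ### Removing the diagonal terms -/

theorem expInt_pos (f : ℝ → ℝ) (a b : ℝ) : 0 < expInt f a b := Real.exp_pos _

@[simp] theorem expInt_self (f : ℝ → ℝ) (a : ℝ) : expInt f a a = 1 := by simp [expInt]

theorem hasDerivWithinAt_expInt {f : ℝ → ℝ} (hf : ContinuousOn f (Ici t₀)) {t : ℝ} (ht : t₀ ≤ t) :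
    HasDerivWithinAt (expInt f t₀) (f t * expInt f t₀ t) (Ici t₀) t := by
  convert! (hasDerivWithinAt_integral_Ici hf ht).exp using 1
  rw [mul_comm, expInt]

theorem expInt_eq_mul {f : ℝ → ℝ} (hf : ContinuousOn f (Ici t₀)) {s t : ℝ} (hs : t₀ ≤ s)
    (ht : t₀ ≤ t) : expInt f s t = expInt f t₀ t * expInt (-f) t₀ s := by
  simp only [expInt, Pi.neg_apply, intervalIntegral.integral_neg, ← Real.exp_add,
    ← sub_eq_add_neg]
  rw [intervalIntegral.integral_interval_sub_left
    (continuousOn_Ici_intervalIntegrable hf le_rfl ht)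
    (continuousOn_Ici_intervalIntegrable hf le_rfl hs)]

theorem Iminus_eq_mul_Iplus {f g : ℝ → ℝ} (hg : ContinuousOn g (Ici t₀)) {t : ℝ} (ht : t₀ ≤ t) :
    Iminus g f t₀ t = expInt (-g) t₀ t * Iplus f (-g) t₀ t := by
  rw [Iminus, Iplus, ← intervalIntegral.integral_const_mul]
  refine intervalIntegral.integral_congr fun s hs => ?_
  rw [uIcc_of_le ht] at hs
  rw [expInt_eq_mul hg.neg hs.1 ht]
  ring

/-- The coefficient `a12 J_{-B}` of the system without diagonal terms. -/
def PlanarSystem.coef12 (A : PlanarSystem) (t₀ : ℝ) : ℝ → ℝ :=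
  fun t => A.a12 t * expInt (-A.B) t₀ t

/-- The coefficient `a21 J_B` of the system without diagonal terms. -/
def PlanarSystem.coef21 (A : PlanarSystem) (t₀ : ℝ) : ℝ → ℝ :=
  fun t => A.a21 t * expInt (-(-A.B)) t₀ t

/-- The diagonal coefficients are continuous on `[t₀, ∞)`. -/
structure PlanarSystem.ContDiag (A : PlanarSystem) (t₀ : ℝ) : Prop where
  a11 : ContinuousOn A.a11 (Ici t₀)
  a22 : ContinuousOn A.a22 (Ici t₀)

namespace PlanarSystem

variable {A : PlanarSystem} {φ ψ : ℝ → ℝ} {t : ℝ}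

theorem ContDiag.B (hA : A.ContDiag t₀) : ContinuousOn A.B (Ici t₀) := hA.a11.sub hA.a22

theorem ContDiag.coef12_eq (hA : A.ContDiag t₀) (ht : t₀ ≤ t) :
    A.coef12 t₀ t = A.a12 t * (expInt A.a22 t₀ t / expInt A.a11 t₀ t) := by
  rw [coef12, expInt, expInt, expInt, ← Real.exp_sub, ← intervalIntegral.integral_sub
    (continuousOn_Ici_intervalIntegrable hA.a22 le_rfl ht)
    (continuousOn_Ici_intervalIntegrable hA.a11 le_rfl ht)]
  simp [PlanarSystem.B]

theorem ContDiag.coef21_eq (hA : A.ContDiag t₀) (ht : t₀ ≤ t) :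
    A.coef21 t₀ t = A.a21 t * (expInt A.a11 t₀ t / expInt A.a22 t₀ t) := by
  rw [coef21, expInt, expInt, expInt, ← Real.exp_sub, ← intervalIntegral.integral_sub
    (continuousOn_Ici_intervalIntegrable hA.a11 le_rfl ht)
    (continuousOn_Ici_intervalIntegrable hA.a22 le_rfl ht)]
  simp [PlanarSystem.B]

theorem ContDiag.expInt_S (hA : A.ContDiag t₀) (ht : t₀ ≤ t) :
    expInt A.S t₀ t = expInt A.a11 t₀ t * expInt A.a22 t₀ t := by
  rw [expInt, expInt, expInt, ← Real.exp_add, ← intervalIntegral.integral_add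
    (continuousOn_Ici_intervalIntegrable hA.a11 le_rfl ht)
    (continuousOn_Ici_intervalIntegrable hA.a22 le_rfl ht)]
  rfl

theorem ContDiag.weight12_eq (hA : A.ContDiag t₀) (φ : ℝ → ℝ) (ht : t₀ ≤ t) :
    A.coef12 t₀ t / (φ t / expInt A.a11 t₀ t) ^ 2 = A.weight12 t₀ φ t := by
  rw [weight12, hA.expInt_S ht, hA.coef12_eq ht]
  have := (expInt_pos A.a11 t₀ t).ne'
  rw [div_pow, div_div_eq_mul_div]
  field_simp

theorem ContDiag.weight21_eq (hA : A.ContDiag t₀) (ψ : ℝ → ℝ) (ht : t₀ ≤ t) :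
    A.coef21 t₀ t / (ψ t / expInt A.a22 t₀ t) ^ 2 = A.weight21 t₀ ψ t := by
  rw [weight21, hA.expInt_S ht, hA.coef21_eq ht]
  have := (expInt_pos A.a22 t₀ t).ne'
  rw [div_pow, div_div_eq_mul_div]
  field_simp

theorem ContDiag.coef12_mul_div (hA : A.ContDiag t₀) (φ ψ : ℝ → ℝ) (ht : t₀ ≤ t) :
    A.coef12 t₀ t * ((ψ t / expInt A.a22 t₀ t) / (φ t / expInt A.a11 t₀ t)) =
      A.a12 t * (ψ t / φ t) := by
  rw [hA.coef12_eq ht]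
  have := (expInt_pos A.a11 t₀ t).ne'
  have := (expInt_pos A.a22 t₀ t).ne'
  rw [div_div_div_eq]
  field_simp

theorem ContDiag.coef21_mul_div (hA : A.ContDiag t₀) (φ ψ : ℝ → ℝ) (ht : t₀ ≤ t) :
    A.coef21 t₀ t * ((φ t / expInt A.a11 t₀ t) / (ψ t / expInt A.a22 t₀ t)) =
      A.a21 t * (φ t / ψ t) := by
  rw [hA.coef21_eq ht]
  have := (expInt_pos A.a11 t₀ t).ne'
  have := (expInt_pos A.a22 t₀ t).ne'
  rw [div_div_div_eq]
  field_simp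

theorem ContDiag.coef21_mul_integral (hA : A.ContDiag t₀) (ht : t₀ ≤ t) :
    A.a21 t * Iminus (-A.B) A.a12 t₀ t = A.coef21 t₀ t * ∫ τ in t₀..t, A.coef12 t₀ τ := by
  rw [Iminus_eq_mul_Iplus hA.B.neg ht, neg_neg, ← mul_assoc]
  simp only [coef21, neg_neg]
  rfl

theorem ContDiag.coef12_mul_integral (hA : A.ContDiag t₀) (ht : t₀ ≤ t) :
    A.a12 t * Iminus A.B A.a21 t₀ t = A.coef12 t₀ t * ∫ τ in t₀..t, A.coef21 t₀ τ := by
  rw [Iminus_eq_mul_Iplus hA.B ht, ← mul_assoc]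
  rfl

theorem ContDiag.isAdmissible_coef12 (hA : A.ContDiag t₀) (hc : ContinuousOn A.a12 (Ici t₀))
    (h0 : ∀ t ≥ t₀, 0 ≤ A.a12 t) (hs : ∀ T ≥ t₀, ∃ t ≥ T, A.a12 t ≠ 0) :
    IsAdmissible (A.coef12 t₀) t₀ where
  cont := hc.mul fun _ ht => (hasDerivWithinAt_expInt hA.B.neg ht).continuousWithinAt
  nonneg t ht := mul_nonneg (h0 t ht) (expInt_pos _ _ _).le
  supp T hT := (hs T hT).imp fun _ h => ⟨h.1, mul_ne_zero h.2 (expInt_pos _ _ _).ne'⟩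

theorem ContDiag.isAdmissible_coef21 (hA : A.ContDiag t₀) (hc : ContinuousOn A.a21 (Ici t₀))
    (h0 : ∀ t ≥ t₀, 0 ≤ A.a21 t) (hs : ∀ T ≥ t₀, ∃ t ≥ T, A.a21 t ≠ 0) :
    IsAdmissible (A.coef21 t₀) t₀ where
  cont := hc.mul fun _ ht => (hasDerivWithinAt_expInt hA.B.neg.neg ht).continuousWithinAt
  nonneg t ht := mul_nonneg (h0 t ht) (expInt_pos _ _ _).le
  supp T hT := (hs T hT).imp fun _ h => ⟨h.1, mul_ne_zero h.2 (expInt_pos _ _ _).ne'⟩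

theorem IsSolution.offDiag (h : A.IsSolution t₀ φ ψ) (hA : A.ContDiag t₀) :
    IsOffDiagSolution (A.coef12 t₀) (A.coef21 t₀) t₀ (fun t => φ t / expInt A.a11 t₀ t)
      (fun t => ψ t / expInt A.a22 t₀ t) := by
  intro t ht
  have h1 := (expInt_pos A.a11 t₀ t).ne'
  have h2 := (expInt_pos A.a22 t₀ t).ne'
  constructor
  · convert! (h t ht).1.div (hasDerivWithinAt_expInt hA.a11 ht) h1 using 1
    rw [hA.coef12_eq ht]
    field_simp
    ring
  · convert! (h t ht).2.div (hasDerivWithinAt_expInt hA.a22 ht) h2 using 1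
    rw [hA.coef21_eq ht]
    field_simp
    ring

/-- Solutions of the system without diagonal terms come from solutions of the full system. -/
theorem exists_isSolution (hA : A.ContDiag t₀)
    (h : IsOffDiagSolution (A.coef12 t₀) (A.coef21 t₀) t₀ x y) :
    ∃ φ ψ, A.IsSolution t₀ φ ψ ∧ x = (fun t => φ t / expInt A.a11 t₀ t) ∧
      y = fun t => ψ t / expInt A.a22 t₀ t := by
  refine ⟨fun t => expInt A.a11 t₀ t * x t, fun t => expInt A.a22 t₀ t * y t, fun t ht => ?_,
    funext fun t => ?_, funext fun t => ?_⟩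
  · have h1 := (expInt_pos A.a11 t₀ t).ne'
    have h2 := (expInt_pos A.a22 t₀ t).ne'
    constructor
    · convert! (hasDerivWithinAt_expInt hA.a11 ht).mul (h t ht).1 using 1
      rw [hA.coef12_eq ht]
      field_simp
    · convert! (hasDerivWithinAt_expInt hA.a22 ht).mul (h t ht).2 using 1
      rw [hA.coef21_eq ht]
      field_simp
      ring
  · rw [mul_div_cancel_left₀ _ (expInt_pos A.a11 t₀ t).ne']
  · rw [mul_div_cancel_left₀ _ (expInt_pos A.a22 t₀ t).ne']

end PlanarSystem

/-! ### Independence and principal solutions of the full system. -/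

theorem linIndepFrom_of_wronskian_ne_zero {φ ψ : ℝ → ℝ} (h : φ t₀ * v t₀ - u t₀ * ψ t₀ ≠ 0) :
    LinIndepFrom t₀ φ ψ u v := by
  refine LinearIndependent.pair_iff.2 fun a b hab => ?_
  have h0 := congrFun hab ⟨t₀, mem_Ici.2 le_rfl⟩
  simp only [Pi.add_apply, Pi.smul_apply, Prod.smul_mk, Prod.mk_add_mk, smul_eq_mul,
    Pi.zero_apply, Prod.mk_eq_zero] at h0
  constructor
  · refine (mul_eq_zero.1 ?_).resolve_right h
    linear_combination v t₀ * h0.1 - u t₀ * h0.2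
  · refine (mul_eq_zero.1 ?_).resolve_right h
    linear_combination φ t₀ * h0.2 - ψ t₀ * h0.1

theorem LinIndepFrom.not_exists_mul {φ ψ : ℝ → ℝ} (h : LinIndepFrom t₀ φ ψ u v) :
    ¬ ∃ c : ℝ, ∀ t ≥ t₀, u t = c * φ t ∧ v t = c * ψ t := by
  rintro ⟨c, hc⟩
  have := (LinearIndependent.pair_iff.1 h c (-1) (funext fun t => by
    simp [(hc t t.2).1, (hc t t.2).2])).2
  norm_num at this

variable {A : PlanarSystem} {φ ψ : ℝ → ℝ}

theorem PlanarSystem.IsSolution.exists_eq_mul (h : A.IsSolution t₀ φ ψ)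
    (h' : A.IsSolution t₀ u v) (hA : A.ContDiag t₀) (hp : IsAdmissible (A.coef12 t₀) t₀)
    (hq : IsAdmissible (A.coef21 t₀) t₀) (h0 : φ t₀ ≠ 0 ∨ ψ t₀ ≠ 0)
    (hW : φ t₀ * v t₀ - u t₀ * ψ t₀ = 0) : ∃ c : ℝ, ∀ t ≥ t₀, u t = c * φ t ∧ v t = c * ψ t := by
  have key : ∃ c : ℝ, ∀ t ≥ t₀, u t / expInt A.a11 t₀ t = c * (φ t / expInt A.a11 t₀ t) ∧
      v t / expInt A.a22 t₀ t = c * (ψ t / expInt A.a22 t₀ t) := by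
    rcases h0 with h0 | h0
    · exact (h.offDiag hA).exists_eq_mul (h'.offDiag hA) hp hq (by simpa using h0)
        (by simpa using hW)
    · obtain ⟨c, hc⟩ := (h.offDiag hA).symm.exists_eq_mul (h'.offDiag hA).symm hq hp
        (by simpa using h0) (by simp only [expInt_self, div_one]; linarith)
      exact ⟨c, fun t ht => (hc t ht).symm⟩
  refine key.imp fun c hc t ht => ⟨?_, ?_⟩
  · have := (hc t ht).1
    rwa [← mul_div_assoc, div_left_inj' (expInt_pos _ _ _).ne'] at this
  · have := (hc t ht).2
    rwa [← mul_div_assoc, div_left_inj' (expInt_pos _ _ _).ne'] at this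

theorem PlanarSystem.IsSolution.exists_nonvanishingFrom (h : A.IsSolution t₀ φ ψ)
    (hA : A.ContDiag t₀) (hp : IsAdmissible (A.coef12 t₀) t₀)
    (hq : IsAdmissible (A.coef21 t₀) t₀) (h0 : ¬ (φ t₀ = 0 ∧ ψ t₀ = 0)) :
    ∃ T ≥ t₀, NonvanishingFrom T φ ψ := by
  obtain ⟨x₁, y₁, x₂, y₂, F⟩ := exists_isFundamental hp hq
  have h1 := F.eventually_ne hp hq (h.offDiag hA) (by simpa using h0)
  have h2 := F.swap.eventually_ne hq hp (h.offDiag hA).symm (by simpa [and_comm] using h0)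
  obtain ⟨T, hT⟩ := eventually_atTop.1 (h1.and h2)
  refine ⟨max T t₀, le_max_right _ _, fun t ht => ?_⟩
  have := hT t ((le_max_left _ _).trans ht)
  exact ⟨(div_ne_zero_iff.1 this.1).1, (div_ne_zero_iff.1 this.2).1⟩

/-- The solution `(φ, ψ)` has a first component that is small compared with that of any other
solution, and correspondingly for the weighted integrals. -/
structure PlanarSystem.IsPrincipalFst (A : PlanarSystem) (t₀ : ℝ) (φ ψ : ℝ → ℝ) : Prop where
  integralTop : IntegralTop (A.weight12 t₀ φ) t₀
  tendsto_div : ∀ u v, A.IsSolution t₀ u v → φ t₀ * v t₀ - u t₀ * ψ t₀ ≠ 0 →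
    Tendsto (fun t => φ t / u t) atTop (𝓝 0)
  integralConv : ∀ u v, A.IsSolution t₀ u v → φ t₀ * v t₀ - u t₀ * ψ t₀ ≠ 0 → ∀ T ≥ t₀,
    (∀ t ≥ T, u t ≠ 0) → IntegralConv (A.weight12 t₀ u) T
  eq_mul_of_tendsto : ∀ u v, A.IsSolution t₀ u v →
    (φ t₀ * v t₀ - u t₀ * ψ t₀ ≠ 0 → Tendsto (fun t => u t / φ t) atTop (𝓝 0)) →
    ∃ c : ℝ, ∀ t ≥ t₀, u t = c * φ t ∧ v t = c * ψ t

/-- The solution `(φ, ψ)` has a second component that is small compared with that of any other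
solution, and correspondingly for the weighted integrals. -/
structure PlanarSystem.IsPrincipalSnd (A : PlanarSystem) (t₀ : ℝ) (φ ψ : ℝ → ℝ) : Prop where
  integralTop : IntegralTop (A.weight21 t₀ ψ) t₀
  tendsto_div : ∀ u v, A.IsSolution t₀ u v → φ t₀ * v t₀ - u t₀ * ψ t₀ ≠ 0 →
    Tendsto (fun t => ψ t / v t) atTop (𝓝 0)
  integralConv : ∀ u v, A.IsSolution t₀ u v → φ t₀ * v t₀ - u t₀ * ψ t₀ ≠ 0 → ∀ T ≥ t₀,
    (∀ t ≥ T, v t ≠ 0) → IntegralConv (A.weight21 t₀ v) T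
  eq_mul_of_tendsto : ∀ u v, A.IsSolution t₀ u v →
    (φ t₀ * v t₀ - u t₀ * ψ t₀ ≠ 0 → Tendsto (fun t => v t / ψ t) atTop (𝓝 0)) →
    ∃ c : ℝ, ∀ t ≥ t₀, u t = c * φ t ∧ v t = c * ψ t

theorem IsPrincipal.isPrincipalFst (h : IsPrincipal (A.coef12 t₀) (A.coef21 t₀) t₀
      (fun t => φ t / expInt A.a11 t₀ t) (fun t => ψ t / expInt A.a22 t₀ t))
    (hs : A.IsSolution t₀ φ ψ) (hA : A.ContDiag t₀) (hp : IsAdmissible (A.coef12 t₀) t₀)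
    (hq : IsAdmissible (A.coef21 t₀) t₀) (hφ : ∀ t ≥ t₀, φ t ≠ 0) :
    A.IsPrincipalFst t₀ φ ψ where
  integralTop := h.integralTop.congr fun t ht => hA.weight12_eq φ ht
  tendsto_div u v huv hW := (h.tendsto_div _ _ (huv.offDiag hA) (by simpa using hW)).congr
    fun t => div_div_div_cancel_right₀ (expInt_pos _ _ _).ne' _ _
  integralConv u v huv hW T hT hu := (h.integralConv hp (huv.offDiag hA) (by simpa using hW) hT
    fun t ht => div_ne_zero (hu t ht) (expInt_pos _ _ _).ne').congr
      fun t ht => hA.weight12_eq u (le_trans hT ht)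
  eq_mul_of_tendsto u v huv hlim := by
    refine hs.exists_eq_mul huv hA hp hq (.inl (hφ t₀ le_rfl)) ?_
    by_cases h0 : u t₀ = 0 ∧ v t₀ = 0
    -- The zero solution is set aside: it is never eventually nonzero, as the quotient argument
    -- requires.
    · simp [h0]
    obtain ⟨T, -, hT⟩ := huv.exists_nonvanishingFrom hA hp hq h0
    have := h.wronskian_eq_zero (huv.offDiag hA)
      (by filter_upwards [eventually_ge_atTop t₀] with t ht using
        div_ne_zero (hφ t ht) (expInt_pos _ _ _).ne')
      (by filter_upwards [eventually_ge_atTop T] with t ht using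
        div_ne_zero (hT t ht).1 (expInt_pos _ _ _).ne')
      fun hW => (hlim (by simpa using hW)).congr
        fun t => (div_div_div_cancel_right₀ (expInt_pos _ _ _).ne' _ _).symm
    simpa using this

theorem IsPrincipal.isPrincipalSnd (h : IsPrincipal (A.coef21 t₀) (A.coef12 t₀) t₀
      (fun t => ψ t / expInt A.a22 t₀ t) (fun t => φ t / expInt A.a11 t₀ t))
    (hs : A.IsSolution t₀ φ ψ) (hA : A.ContDiag t₀) (hp : IsAdmissible (A.coef12 t₀) t₀)
    (hq : IsAdmissible (A.coef21 t₀) t₀) (hψ : ∀ t ≥ t₀, ψ t ≠ 0) :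
    A.IsPrincipalSnd t₀ φ ψ := by
  have hswap : ∀ u v : ℝ → ℝ, φ t₀ * v t₀ - u t₀ * ψ t₀ ≠ 0 →
      ψ t₀ / expInt A.a22 t₀ t₀ * (u t₀ / expInt A.a11 t₀ t₀) -
        v t₀ / expInt A.a22 t₀ t₀ * (φ t₀ / expInt A.a11 t₀ t₀) ≠ 0 := by
    intro u v hW
    simp only [expInt_self, div_one]
    contrapose! hW
    linarith
  refine ⟨h.integralTop.congr fun t ht => hA.weight21_eq ψ ht, fun u v huv hW =>
    (h.tendsto_div _ _ (huv.offDiag hA).symm (hswap u v hW)).congr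
      fun t => div_div_div_cancel_right₀ (expInt_pos _ _ _).ne' _ _,
    fun u v huv hW T hT hv => (h.integralConv hq (huv.offDiag hA).symm (hswap u v hW) hT
      fun t ht => div_ne_zero (hv t ht) (expInt_pos _ _ _).ne').congr
        fun t ht => hA.weight21_eq v (le_trans hT ht), fun u v huv hlim => ?_⟩
  refine hs.exists_eq_mul huv hA hp hq (.inr (hψ t₀ le_rfl)) ?_
  by_cases h0 : u t₀ = 0 ∧ v t₀ = 0
  · simp [h0]
  obtain ⟨T, -, hT⟩ := huv.exists_nonvanishingFrom hA hp hq h0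
  have := h.wronskian_eq_zero (huv.offDiag hA).symm
    (by filter_upwards [eventually_ge_atTop t₀] with t ht using
      div_ne_zero (hψ t ht) (expInt_pos _ _ _).ne')
    (by filter_upwards [eventually_ge_atTop T] with t ht using
      div_ne_zero (hT t ht).2 (expInt_pos _ _ _).ne')
    fun hW => (hlim (by
      simp only [expInt_self, div_one] at hW
      contrapose! hW
      linarith)).congr
      fun t => (div_div_div_cancel_right₀ (expInt_pos _ _ _).ne' _ _).symm
  simp only [expInt_self, div_one] at this
  linarith

theorem LinIndepFrom.wronskian_ne_zero (h : LinIndepFrom t₀ φ ψ u v) (hs : A.IsSolution t₀ φ ψ)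
    (hs' : A.IsSolution t₀ u v) (hA : A.ContDiag t₀) (hp : IsAdmissible (A.coef12 t₀) t₀)
    (hq : IsAdmissible (A.coef21 t₀) t₀) (h0 : φ t₀ ≠ 0 ∨ ψ t₀ ≠ 0) :
    φ t₀ * v t₀ - u t₀ * ψ t₀ ≠ 0 :=
  fun hW => h.not_exists_mul (hs.exists_eq_mul hs' hA hp hq h0 hW)

end

/-! ### The main theorem. -/

theorem theorem3p8 (t₀ : ℝ) (A : PlanarSystem)
    (hc11 : ContinuousOn A.a11 (Ici t₀)) (hc12 : ContinuousOn A.a12 (Ici t₀))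
    (hc21 : ContinuousOn A.a21 (Ici t₀)) (hc22 : ContinuousOn A.a22 (Ici t₀))
    (hs12 : ∀ T ≥ t₀, ∃ t ≥ T, A.a12 t ≠ 0) (hs21 : ∀ T ≥ t₀, ∃ t ≥ T, A.a21 t ≠ 0)
    (h12 : ∀ t ≥ t₀, 0 ≤ A.a12 t) (h21 : ∀ t ≥ t₀, 0 ≤ A.a21 t) :
    -- the case where at least one of the two integrals is infinite
    ((IplusInfinite A.a12 A.B t₀ ∨ IplusInfinite A.a21 (-A.B) t₀) →
      ∃ φs ψs : ℝ → ℝ, A.IsSolution t₀ φs ψs ∧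
        (∀ t ≥ t₀, 0 < φs t ∧ ψs t < 0) ∧
        (∀ u v : ℝ → ℝ, A.IsSolution t₀ u v → (∀ t ≥ t₀, 0 < u t ∧ v t < 0) →
          ∃ c : ℝ, 0 < c ∧ ∀ t ≥ t₀, u t = c * φs t ∧ v t = c * ψs t) ∧
        IntegralTop (A.weight12 t₀ φs) t₀ ∧
        IntegralTop (A.weight21 t₀ ψs) t₀ ∧
        (∀ φ ψ : ℝ → ℝ, A.IsSolution t₀ φ ψ → LinIndepFrom t₀ φs ψs φ ψ →
          Tendsto (fun t => φs t / φ t) atTop (𝓝 0) ∧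
          Tendsto (fun t => ψs t / ψ t) atTop (𝓝 0) ∧
          (∃ T ≥ t₀, NonvanishingFrom T φ ψ) ∧
          ∀ T ≥ t₀, NonvanishingFrom T φ ψ →
            IntegralConv (A.weight12 t₀ φ) T ∧
            IntegralConv (A.weight21 t₀ ψ) T ∧
            (IplusInfinite A.a12 A.B t₀ → IntegralTop (fun τ => A.a12 τ * (ψ τ / φ τ)) T) ∧
            (IplusInfinite A.a21 (-A.B) t₀ → IntegralTop (fun τ => A.a21 τ * (φ τ / ψ τ)) T)) ∧
        (IplusInfinite A.a12 A.B t₀ → IntegralBot (fun τ => A.a21 τ * (φs τ / ψs τ)) t₀) ∧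
        (IplusInfinite A.a21 (-A.B) t₀ → IntegralBot (fun τ => A.a12 τ * (ψs τ / φs τ)) t₀) ∧
        (IplusInfinite A.a12 A.B t₀ →
          IntegralConv (fun τ => A.a21 τ * Iminus (-A.B) A.a12 t₀ τ) t₀ →
            IntegralConv (fun τ => A.a12 τ * |ψs τ / φs τ|) t₀ ∧
            IntegralBot (fun τ => A.a21 τ * (φs τ / ψs τ)) t₀) ∧
        (IplusInfinite A.a21 (-A.B) t₀ →
          IntegralConv (fun τ => A.a12 τ * Iminus A.B A.a21 t₀ τ) t₀ →
            IntegralConv (fun τ => A.a21 τ * |φs τ / ψs τ|) t₀ ∧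
            IntegralBot (fun τ => A.a12 τ * (ψs τ / φs τ)) t₀)) ∧
    -- the case where both integrals are finite
    (IplusFinite A.a12 A.B t₀ → IplusFinite A.a21 (-A.B) t₀ →
      ∃ φss ψo φo ψss : ℝ → ℝ, A.IsSolution t₀ φss ψo ∧ A.IsSolution t₀ φo ψss ∧
        LinIndepFrom t₀ φss ψo φo ψss ∧
        (∀ t ≥ t₀, 0 < φss t ∧ 0 < ψss t) ∧
        IntegralTop (A.weight12 t₀ φss) t₀ ∧
        IntegralTop (A.weight21 t₀ ψss) t₀ ∧
        (∀ φ ψ : ℝ → ℝ, A.IsSolution t₀ φ ψ → LinIndepFrom t₀ φss ψo φ ψ →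
          Tendsto (fun t => φss t / φ t) atTop (𝓝 0) ∧
          (∃ T ≥ t₀, NonvanishingFrom T φ ψ) ∧
          ∀ T ≥ t₀, NonvanishingFrom T φ ψ → IntegralConv (A.weight12 t₀ φ) T) ∧
        (∀ φ ψ : ℝ → ℝ, A.IsSolution t₀ φ ψ → LinIndepFrom t₀ φo ψss φ ψ →
          Tendsto (fun t => ψss t / ψ t) atTop (𝓝 0) ∧
          (∃ T ≥ t₀, NonvanishingFrom T φ ψ) ∧
          ∀ T ≥ t₀, NonvanishingFrom T φ ψ → IntegralConv (A.weight21 t₀ ψ) T) ∧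
        -- uniqueness up to a multiplier, by minimality of the first component
        (∀ u v : ℝ → ℝ, A.IsSolution t₀ u v →
          (∀ φ ψ : ℝ → ℝ, A.IsSolution t₀ φ ψ → LinIndepFrom t₀ u v φ ψ →
            Tendsto (fun t => u t / φ t) atTop (𝓝 0)) →
          ∃ c : ℝ, ∀ t ≥ t₀, u t = c * φss t ∧ v t = c * ψo t) ∧
        -- uniqueness up to a multiplier, by minimality of the second component
        (∀ u v : ℝ → ℝ, A.IsSolution t₀ u v →
          (∀ φ ψ : ℝ → ℝ, A.IsSolution t₀ φ ψ → LinIndepFrom t₀ u v φ ψ →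
            Tendsto (fun t => v t / ψ t) atTop (𝓝 0)) →
          ∃ c : ℝ, ∀ t ≥ t₀, u t = c * φo t ∧ v t = c * ψss t)) := by
  have hA : A.ContDiag t₀ := ⟨hc11, hc22⟩
  have hp := hA.isAdmissible_coef12 hc12 h12 hs12
  have hq := hA.isAdmissible_coef21 hc21 h21 hs21
  refine ⟨fun htop => ?_, fun hpc hqc => ?_⟩
  -- `Iplus` unfolds to the primitives of `coef12` and `coef21` (hence the double negation in
  -- `coef21`), so `htop` already speaks of `p` and `q`.
  · obtain ⟨x, y, hPx, hPy, hsign, huniq, hlog⟩ := exists_principal_of_integralTop hp hq htop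
    obtain ⟨φs, ψs, hs, rfl, rfl⟩ := PlanarSystem.exists_isSolution hA hPx.sol
    have hφs : ∀ t ≥ t₀, 0 < φs t := fun t ht =>
      (div_pos_iff_of_pos_right (expInt_pos _ _ _)).1 (hsign t ht).1
    have hψs : ∀ t ≥ t₀, ψs t < 0 := fun t ht =>
      not_le.1 fun h0 => (hsign t ht).2.not_ge (div_nonneg h0 (expInt_pos _ _ _).le)
    have hF := hPx.isPrincipalFst hs hA hp hq fun t ht => (hφs t ht).ne'
    have hS := hPy.isPrincipalSnd hs hA hp hq fun t ht => (hψs t ht).ne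
    have hbot12 : IplusInfinite A.a12 A.B t₀ →
        IntegralBot (fun τ => A.a21 τ * (φs τ / ψs τ)) t₀ := fun h =>
      (hPx.sol.integralBot_of_integralTop hp hq (fun t ht => (hsign t ht).1)
        (fun t ht => (hsign t ht).2) h).congr fun t ht => hA.coef21_mul_div φs ψs ht
    -- Exchanging the components reverses the sign pattern. The pair `(-y, -x)` restores it, so the
    -- results for `p` apply to `q`; the zero terms match the shape of `linearComb`.
    have hneg : ∀ t ≥ t₀, 0 < -1 * (ψs t / expInt A.a22 t₀ t) + 0 * (ψs t / expInt A.a22 t₀ t) ∧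
        -1 * (φs t / expInt A.a11 t₀ t) + 0 * (φs t / expInt A.a11 t₀ t) < 0 := fun t ht =>
      ⟨by linarith [(hsign t ht).2], by linarith [(hsign t ht).1]⟩
    have hnegsol := hPy.sol.linearComb hPy.sol (-1) 0
    have hbot21 : IplusInfinite A.a21 (-A.B) t₀ →
        IntegralBot (fun τ => A.a12 τ * (ψs τ / φs τ)) t₀ := fun h =>
      (hnegsol.integralBot_of_integralTop hq hp (fun t ht => (hneg t ht).1)
        (fun t ht => (hneg t ht).2) h).congr fun t ht => by
          rw [← hA.coef12_mul_div φs ψs ht]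
          simp only [zero_mul, add_zero, neg_one_mul, neg_div_neg_eq]
    refine ⟨φs, ψs, hs, fun t ht => ⟨hφs t ht, hψs t ht⟩, fun u v huv hsg => ?_, hF.integralTop,
      hS.integralTop, fun φ ψ h hli => ?_, hbot12, hbot21, fun h hconv => ⟨?_, hbot12 h⟩,
      fun h hconv => ⟨?_, hbot21 h⟩⟩
    · have hW := huniq _ _ (huv.offDiag hA) fun t ht =>
        ⟨div_pos (hsg t ht).1 (expInt_pos _ _ _),
          div_neg_of_neg_of_pos (hsg t ht).2 (expInt_pos _ _ _)⟩
      simp only [expInt_self, div_one] at hW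
      obtain ⟨c, hc⟩ := hs.exists_eq_mul huv hA hp hq (.inl (hφs t₀ le_rfl).ne') hW
      refine ⟨c, ?_, hc⟩
      have h1 := (hsg t₀ le_rfl).1
      rw [(hc t₀ le_rfl).1] at h1
      exact pos_of_mul_pos_left h1 (hφs t₀ le_rfl).le
    · have hW := hli.wronskian_ne_zero hs h hA hp hq (.inl (hφs t₀ le_rfl).ne')
      refine ⟨hF.tendsto_div φ ψ h hW, hS.tendsto_div φ ψ h hW,
        h.exists_nonvanishingFrom hA hp hq fun h0 => hW (by simp [h0]), fun T hT hne => ?_⟩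
      have hlog' := hlog _ _ (h.offDiag hA) (by simpa using hW)
      refine ⟨hF.integralConv φ ψ h hW T hT fun t ht => (hne t ht).1,
        hS.integralConv φ ψ h hW T hT fun t ht => (hne t ht).2, fun hi => ?_, fun hi => ?_⟩
      · exact ((h.offDiag hA).integralTop_log_deriv hp hT
          (fun t ht => div_ne_zero (hne t ht).1 (expInt_pos _ _ _).ne') (hlog'.1 hi)).congr
            fun t ht => hA.coef12_mul_div φ ψ (le_trans hT ht)
      · exact ((h.offDiag hA).symm.integralTop_log_deriv hq hT
          (fun t ht => div_ne_zero (hne t ht).2 (expInt_pos _ _ _).ne') (hlog'.2 hi)).congr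
            fun t ht => hA.coef21_mul_div φ ψ (le_trans hT ht)
    · refine (hPx.sol.integralConv_of_integralConv hp hq (fun t ht => (hsign t ht).1)
        (fun t ht => (hsign t ht).2) h
        (hconv.congr fun t ht => hA.coef21_mul_integral ht)).congr fun t ht => ?_
      have := congrArg abs (hA.coef12_mul_div φs ψs ht)
      rwa [abs_mul, abs_mul, abs_of_nonneg (hp.nonneg t ht), abs_of_nonneg (h12 t ht)] at this
    · refine (hnegsol.integralConv_of_integralConv hq hp (fun t ht => (hneg t ht).1)
        (fun t ht => (hneg t ht).2) h
        (hconv.congr fun t ht => hA.coef12_mul_integral ht)).congr fun t ht => ?_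
      have := congrArg abs (hA.coef21_mul_div φs ψs ht)
      rw [abs_mul, abs_mul, abs_of_nonneg (hq.nonneg t ht), abs_of_nonneg (h21 t ht)] at this
      rw [← this]
      simp only [zero_mul, add_zero, neg_one_mul, neg_div_neg_eq]
  · obtain ⟨x, y, x', y', hPx, hPy, hW, hpos⟩ := exists_principal_of_integralConv hp hq hpc hqc
    obtain ⟨φss, ψo, hs, rfl, rfl⟩ := PlanarSystem.exists_isSolution hA hPx.sol
    obtain ⟨φo, ψss, hs', rfl, rfl⟩ := PlanarSystem.exists_isSolution hA hPy.sol.symm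
    have hφss : ∀ t ≥ t₀, 0 < φss t := fun t ht =>
      (div_pos_iff_of_pos_right (expInt_pos _ _ _)).1 (hpos t ht).1
    have hψss : ∀ t ≥ t₀, 0 < ψss t := fun t ht =>
      (div_pos_iff_of_pos_right (expInt_pos _ _ _)).1 (hpos t ht).2
    have hF := hPx.isPrincipalFst hs hA hp hq fun t ht => (hφss t ht).ne'
    have hS := hPy.isPrincipalSnd hs' hA hp hq fun t ht => (hψss t ht).ne'
    refine ⟨φss, ψo, φo, ψss, hs, hs', linIndepFrom_of_wronskian_ne_zero (by simpa using hW),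
      fun t ht => ⟨hφss t ht, hψss t ht⟩, hF.integralTop, hS.integralTop, fun φ ψ h hli => ?_,
      -- For uniqueness, the competing solution is the principal one itself: each would be small
      -- compared with the other.
      fun φ ψ h hli => ?_, fun u v huv hlim => hF.eq_mul_of_tendsto u v huv fun hW =>
        hlim φss ψo hs (linIndepFrom_of_wronskian_ne_zero ?_),
      fun u v huv hlim => hS.eq_mul_of_tendsto u v huv fun hW =>
        hlim φo ψss hs' (linIndepFrom_of_wronskian_ne_zero ?_)⟩
    · have hW := hli.wronskian_ne_zero hs h hA hp hq (.inl (hφss t₀ le_rfl).ne')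
      exact ⟨hF.tendsto_div φ ψ h hW,
        h.exists_nonvanishingFrom hA hp hq fun h0 => hW (by simp [h0]),
        fun T hT hne => hF.integralConv φ ψ h hW T hT fun t ht => (hne t ht).1⟩
    · have hW := hli.wronskian_ne_zero hs' h hA hp hq (.inr (hψss t₀ le_rfl).ne')
      exact ⟨hS.tendsto_div φ ψ h hW,
        h.exists_nonvanishingFrom hA hp hq fun h0 => hW (by simp [h0]),
        fun T hT hne => hS.integralConv φ ψ h hW T hT fun t ht => (hne t ht).2⟩
    · contrapose! hW
      linarith
    · contrapose! hW
      linarith
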